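/- Let $K$ be a field of arbitrary characteristic, let $n\ge 0$, and let $S$ be either the polynomial ring $K[x_1,\dots,x_n]$ or the power series ring $K[[x_1,\dots,x_n]]$; put $\mathfrak n=(x_1,\dots,x_n)$. Let $I\subsetneq S$ be a proper ideal, assumed to be graded (for the standard grading) if $S$ is the polynomial ring. For $f\in S$ and $r=1,\dots,n$ set $$d^r(f)=\frac{f(0,\dots,0,x_r,x_{r+1},\dots,x_n)-f(0,\dots,0,0,x_{r+1},\dots,x_n)}{x_r}\in S .$$ Let $\Omega$ be the Koszul complex of $x_1,\dots,x_n$: $\Omega_i=\bigwedge^i\Omega_1$, where $\Omega_1$ is the free $S$-module with basis $dx_1,\dots,dx_n$, with the $S$-linear differential $$\partial(dx_{r_1}\wedge\dots\wedge dx_{r_i})=\sum_{k=1}^i(-1)^{k+1}x_{r_k}\,dx_{r_1}\wedge\dots\wedge\widehat{dx_{r_k}}\wedge\dots\wedge dx_{r_i},$$ and let $H_i(\Omega\otimes_S S/I)$ be the homology of the complex $\Omega\otimes_S S/I$. Let $\cdots\to F_2\xrightarrow{\delta_2}F_1\xrightarrow{\delta_1}F_0\xrightarrow{\varepsilon}S/I\to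 0$ be a minimal free resolution of $S/I$ over $S$, i.e. an exact sequence of $S$-linear maps in which every $F_i$ is a finitely generated free $S$-module and $\delta_i(F_i)\subseteq\mathfrak nF_{i-1}$ for all $i\ge1$. For each $i$ choose a basis $e_{i1},\dots,e_{ib_i}$ of $F_i$, and define $\alpha^{(i)}_{kj}\in S$ by $\delta_i(e_{ij})=\sum_{k=1}^{b_{i-1}}\alpha^{(i)}_{kj}e_{i-1,k}$. Then $b_0=1$. Put $j_0=1$. For $i=1,\dots,n$ and $j=1,\dots,b_i$ let $$z_{ij}=\sum_{1\le r_1<\dots<r_i\le n}\ \sum_{j_1=1}^{b_1}\cdots\sum_{j_{i-1}=1}^{b_{i-1}} d^{r_1}\bigl(\alpha^{(1)}_{j_0j_1}\bigr)\,d^{r_2}\bigl(\alpha^{(2)}_{j_1j_2}\bigr)\cdots d^{r_i}\bigl(\alpha^{(i)}_{j_{i-1}j}\bigr)\,dx_{r_1}\wedge\dots\wedge dx_{r_i}\in\Omega_i$$ (where $j_i=j$), and let $\bar z_{ij}$ be its image in $\Omega_i\otimes_S S/I$. Then all $\bar z_{ij}$ are cycles of $\Omega\otimes_S S/I$, and for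 every $i=1,\dots,n$ the homology classes $[\bar z_{i1}],\dots,[\bar z_{ib_i}]$ form a $K$-basis of $H_i(\Omega\otimes_S S/I)$. -/

import Mathlib

open scoped TensorProduct

attribute [local instance] MvPolynomial.gradedAlgebra

namespace KoszulCycles

section Koszul

/-! The Koszul complex of a sequence `x : Fin n → S`.
`Ω_i` is the `i`-th exterior power `⋀[S]^i (Fin n → S)` of the free module with basis
`dx_1, …, dx_n` (the standard basis of `Fin n → S`). -/

variable {S : Type*} [CommRing S] {n : ℕ}

/-- The linear form on the free module `⨁ S dx_r` that sends `dx_r` to `x r`. -/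
def linForm (x : Fin n → S) : Module.Dual S (Fin n → S) := Fintype.linearCombination S x

/-- The Koszul differential on the whole exterior algebra: the contraction with `dx_r ↦ x r`.
It is the `S`-linear map determined by `∂ 1 = 0` and `∂ (a ∧ w) = x_a w - a ∧ ∂ w` for `a` of
degree one, i.e.
`∂ (dx_{r_1} ∧ … ∧ dx_{r_i}) = ∑ k, (-1)^(k+1) x_{r_k} dx_{r_1} ∧ … (omit dx_{r_k}) … ∧ dx_{r_i}`. -/
def koszulD (x : Fin n → S) :
    ExteriorAlgebra S (Fin n → S) →ₗ[S] ExteriorAlgebra S (Fin n → S) :=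
  CliffordAlgebra.contractLeft (Q := (0 : QuadraticForm S (Fin n → S))) (linForm x)

theorem koszulD_ι_mul (x : Fin n → S) (a : Fin n → S) (w : ExteriorAlgebra S (Fin n → S)) :
    koszulD x (ExteriorAlgebra.ι S a * w)
      = linForm x a • w - ExteriorAlgebra.ι S a * koszulD x w :=
  CliffordAlgebra.contractLeft_ι_mul _ _ _

theorem koszulD_algebraMap (x : Fin n → S) (s : S) :
    koszulD x (algebraMap S (ExteriorAlgebra S (Fin n → S)) s) = 0 :=
  CliffordAlgebra.contractLeft_algebraMap (Q := (0 : QuadraticForm S (Fin n → S))) (linForm x) s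

theorem koszulD_mem (x : Fin n → S) (i : ℕ) (w : ExteriorAlgebra S (Fin n → S))
    (hw : w ∈ ⋀[S]^(i + 1) (Fin n → S)) : koszulD x w ∈ ⋀[S]^i (Fin n → S) := by
  induction i generalizing w with
  | zero =>
    change w ∈ (LinearMap.range (ExteriorAlgebra.ι S (M := Fin n → S))) ^ (0 + 1) at hw
    change _ ∈ (LinearMap.range (ExteriorAlgebra.ι S (M := Fin n → S))) ^ 0
    rw [zero_add, pow_one] at hw
    obtain ⟨a, rfl⟩ := hw
    rw [pow_zero, ← mul_one (ExteriorAlgebra.ι S a), koszulD_ι_mul,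
      ← map_one (algebraMap S (ExteriorAlgebra S (Fin n → S))), koszulD_algebraMap, mul_zero,
      sub_zero, map_one]
    exact Submodule.smul_mem _ _ (Submodule.one_le.mp le_rfl)
  | succ i ih =>
    change w ∈ (LinearMap.range (ExteriorAlgebra.ι S (M := Fin n → S))) ^ (i + 1 + 1) at hw
    rw [pow_succ'] at hw
    refine Submodule.mul_induction_on hw ?_ ?_
    · rintro _ ⟨a, rfl⟩ v hv
      rw [koszulD_ι_mul]
      refine Submodule.sub_mem _ (Submodule.smul_mem _ _ hv) ?_
      change _ ∈ (LinearMap.range (ExteriorAlgebra.ι S (M := Fin n → S))) ^ (i + 1)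
      rw [pow_succ']
      exact Submodule.mul_mem_mul ⟨a, rfl⟩ (ih v hv)
    · intro v w hv hw
      rw [map_add]
      exact Submodule.add_mem _ hv hw

/-- The module `Ω_i`, the `i`-th exterior power of `⨁ S dx_r`. -/
def Omega (S : Type*) [CommRing S] (n i : ℕ) : Type _ := ⋀[S]^i (Fin n → S)

instance instAddCommGroupOmega (n i : ℕ) : AddCommGroup (Omega S n i) :=
  inferInstanceAs (AddCommGroup (⋀[S]^i (Fin n → S)))

instance instModuleOmega (n i : ℕ) : Module S (Omega S n i) :=
  inferInstanceAs (Module S (⋀[S]^i (Fin n → S)))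

/-- The Koszul differential `∂_{i+1} : Ω_{i+1} → Ω_i`. -/
def koszulDiff (x : Fin n → S) (i : ℕ) : Omega S n (i + 1) →ₗ[S] Omega S n i :=
  ((koszulD x).restrict (koszulD_mem x i) :
    ⋀[S]^(i + 1) (Fin n → S) →ₗ[S] ⋀[S]^i (Fin n → S))

/-- The element `dx_{r_1} ∧ … ∧ dx_{r_i}` of `Ω_i`. -/
def dx {i : ℕ} (r : Fin i → Fin n) : Omega S n i :=
  (exteriorPower.ιMulti S i fun l => (Pi.single (r l) 1 : Fin n → S) : ⋀[S]^i (Fin n → S))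

/-- The module `Ω_i ⊗ S/I` in degree `i` of the complex `Ω ⊗ S/I`
(written with the factor `S/I` on the left). -/
def KoszulMod (n : ℕ) (I : Ideal S) (i : ℕ) : Type _ := (S ⧸ I) ⊗[S] Omega S n i

noncomputable instance instAddCommGroupKoszulMod (I : Ideal S) (i : ℕ) :
    AddCommGroup (KoszulMod n I i) :=
  inferInstanceAs (AddCommGroup ((S ⧸ I) ⊗[S] Omega S n i))

noncomputable instance instModuleKoszulMod (I : Ideal S) (i : ℕ) :
    Module S (KoszulMod n I i) :=
  inferInstanceAs (Module S ((S ⧸ I) ⊗[S] Omega S n i))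

/-- The canonical map `Ω_i → Ω_i ⊗ S/I`. -/
noncomputable def toKoszulMod (n : ℕ) (I : Ideal S) (i : ℕ) : Omega S n i →ₗ[S] KoszulMod n I i :=
  (TensorProduct.mk S (S ⧸ I) (Omega S n i) 1 : Omega S n i →ₗ[S] (S ⧸ I) ⊗[S] Omega S n i)

/-- The differential `Ω_{i+1} ⊗ S/I → Ω_i ⊗ S/I`. -/
noncomputable def koszulDiffMod (x : Fin n → S) (I : Ideal S) (i : ℕ) :
    KoszulMod n I (i + 1) →ₗ[S] KoszulMod n I i :=
  ((koszulDiff x i).lTensor (S ⧸ I) :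
    (S ⧸ I) ⊗[S] Omega S n (i + 1) →ₗ[S] (S ⧸ I) ⊗[S] Omega S n i)

/-- The `i`-cycles of `Ω ⊗ S/I`. -/
noncomputable def cycles (x : Fin n → S) (I : Ideal S) : (i : ℕ) → Submodule S (KoszulMod n I i)
  | 0 => ⊤
  | i + 1 => LinearMap.ker (koszulDiffMod x I i)

/-- The `i`-boundaries of `Ω ⊗ S/I`. -/
noncomputable def boundaries (x : Fin n → S) (I : Ideal S) (i : ℕ) :
    Submodule S (KoszulMod n I i) :=
  LinearMap.range (koszulDiffMod x I i)

/-- The Koszul homology `H_i(Ω ⊗ S/I)`, cycles modulo boundaries. -/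
def KoszulHomology (x : Fin n → S) (I : Ideal S) (i : ℕ) : Type _ :=
  (cycles x I i) ⧸ (boundaries x I i).submoduleOf (cycles x I i)

noncomputable instance instAddCommGroupKoszulHomology (x : Fin n → S) (I : Ideal S) (i : ℕ) :
    AddCommGroup (KoszulHomology x I i) :=
  inferInstanceAs (AddCommGroup
    ((cycles x I i) ⧸ (boundaries x I i).submoduleOf (cycles x I i)))

noncomputable instance instModuleKoszulHomology (x : Fin n → S) (I : Ideal S) (i : ℕ) :
    Module S (KoszulHomology x I i) :=
  inferInstanceAs (Module S
    ((cycles x I i) ⧸ (boundaries x I i).submoduleOf (cycles x I i)))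

/-- If `S` is a `K`-algebra, `H_i(Ω ⊗ S/I)` is a `K`-vector space by restriction of scalars
along `K → S`. -/
noncomputable instance instFieldModuleKoszulHomology {K : Type*} [Field K] [Algebra K S]
    (x : Fin n → S) (I : Ideal S) (i : ℕ) : Module K (KoszulHomology x I i) :=
  Module.compHom _ (algebraMap K S)

/-- The homology class of a cycle. -/
noncomputable def homologyClass (x : Fin n → S) (I : Ideal S) (i : ℕ) (c : KoszulMod n I i)
    (hc : c ∈ cycles x I i) : KoszulHomology x I i :=
  ((boundaries x I i).submoduleOf (cycles x I i)).mkQ ⟨c, hc⟩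

end Koszul

section Resolution

variable {S : Type*} [CommRing S]

/-- `⋯ → F 2 → F 1 → F 0 → S/I → 0` (maps `δ i : F (i+1) → F i` and `ε`) is a free resolution of
`S/I` by finite free modules, and it is minimal with respect to the (graded) maximal
ideal `𝔫`: `δ i (F (i+1)) ⊆ 𝔫 F i`. -/
structure IsMinimalFreeResolution (𝔫 I : Ideal S) {F : ℕ → Type*}
    [∀ i, AddCommGroup (F i)] [∀ i, Module S (F i)]
    (ε : F 0 →ₗ[S] S ⧸ I) (δ : ∀ i, F (i + 1) →ₗ[S] F i) : Prop where
  free : ∀ i, Module.Free S (F i)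
  finite : ∀ i, Module.Finite S (F i)
  surjective : Function.Surjective ε
  exact_zero : Function.Exact (δ 0) ε
  exact_succ : ∀ i, Function.Exact (δ (i + 1)) (δ i)
  minimal : ∀ i, LinearMap.range (δ i) ≤ 𝔫 • (⊤ : Submodule S (F i))

/-- The matrix `α^{(i+1)}` of `δ i : F (i+1) → F i` with respect to the chosen bases:
`δ i (e_{i+1,j}) = ∑ k, α^{(i+1)}_{k j} e_{i,k}`. -/
noncomputable def diffMatrix {F : ℕ → Type*} [∀ i, AddCommGroup (F i)] [∀ i, Module S (F i)]
    (δ : ∀ i, F (i + 1) →ₗ[S] F i) {b : ℕ → ℕ} (e : ∀ i, Module.Basis (Fin (b i)) S (F i))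
    (i : ℕ) : Matrix (Fin (b i)) (Fin (b (i + 1))) S :=
  Matrix.of fun k j => (e i).repr (δ i (e (i + 1) j)) k

variable {n : ℕ}

/-- For matrices `α i` (standing for `α^{(i+1)}`), operators `d r` and indices `r_1, …, r_i`, the
entry `(j₀, j)` of this matrix is
`∑_{j_1, …, j_{i-1}} d^{r_1}(α^{(1)}_{j₀ j_1}) ⋯ d^{r_i}(α^{(i)}_{j_{i-1} j})`,
the entry of the matrix product `d^{r_1}(α^{(1)}) ⋯ d^{r_i}(α^{(i)})`. -/
def prodMatrix (d : Fin n → S → S) {b : ℕ → ℕ}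
    (α : ∀ i, Matrix (Fin (b i)) (Fin (b (i + 1))) S) :
    (i : ℕ) → (Fin i → Fin n) → Matrix (Fin (b 0)) (Fin (b i)) S
  | 0, _ => 1
  | i + 1, r => prodMatrix d α i (fun l => r l.castSucc) * (α i).map (d (r (Fin.last i)))

/-- `z_{ij} = ∑_{r_1 < ⋯ < r_i} ∑_{j_1, …, j_{i-1}}
d^{r_1}(α^{(1)}_{j₀ j_1}) ⋯ d^{r_i}(α^{(i)}_{j_{i-1} j}) dx_{r_1} ⋯ dx_{r_i}` in `Ω_i`. -/
noncomputable def zElem (d : Fin n → S → S) {b : ℕ → ℕ}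
    (α : ∀ i, Matrix (Fin (b i)) (Fin (b (i + 1))) S) (j₀ : Fin (b 0)) (i : ℕ) (j : Fin (b i)) :
    Omega S n i :=
  ∑ r : Fin i ↪o Fin n,
    prodMatrix d α i r j₀ j • dx r

/-- The image `z̄_{ij}` of `z_{ij}` in `Ω_i ⊗ S/I`. -/
noncomputable def zBar (I : Ideal S) (d : Fin n → S → S) {b : ℕ → ℕ}
    (α : ∀ i, Matrix (Fin (b i)) (Fin (b (i + 1))) S) (j₀ : Fin (b 0)) (i : ℕ) (j : Fin (b i)) :
    KoszulMod n I i :=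
  toKoszulMod n I i (zElem d α j₀ i j)

end Resolution

section Operators

variable {K : Type*} [Field K] {n : ℕ}

/-- For a polynomial `f`, the polynomial obtained from `f` by setting the first `r` variables
equal to zero. -/
noncomputable def polyRestrict (r : ℕ) (f : MvPolynomial (Fin n) K) : MvPolynomial (Fin n) K :=
  MvPolynomial.aeval
    (fun i : Fin n => if (i : ℕ) < r then 0 else (MvPolynomial.X i : MvPolynomial (Fin n) K)) f

/-- The operator `d^r` on polynomials,
`d^r(f) = (f(0,…,0,x_r,…,x_n) - f(0,…,0,x_{r+1},…,x_n)) / x_r`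
(with the variables numbered from `0` here, so that `r` variables come before `X r`). -/
noncomputable def polyD (r : Fin n) (f : MvPolynomial (Fin n) K) : MvPolynomial (Fin n) K :=
  (polyRestrict (r : ℕ) f - polyRestrict ((r : ℕ) + 1) f).divMonomial (Finsupp.single r 1)

open Classical in
/-- For a power series `f`, the power series obtained from `f` by setting the first `r` variables
equal to zero: only the monomials in which these variables do not occur are kept. -/
noncomputable def psRestrict (r : ℕ) (f : MvPowerSeries (Fin n) K) : MvPowerSeries (Fin n) K :=
  fun m => if ∀ i : Fin n, (i : ℕ) < r → m i = 0 then MvPowerSeries.coeff m f else 0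

/-- The operator `d^r` on power series,
`d^r(f) = (f(0,…,0,x_r,…,x_n) - f(0,…,0,x_{r+1},…,x_n)) / x_r`; the numerator is divisible by
`x_r`, and dividing by `x_r` shifts the coefficients. -/
noncomputable def psD (r : Fin n) (f : MvPowerSeries (Fin n) K) : MvPowerSeries (Fin n) K :=
  fun m => MvPowerSeries.coeff (m + Finsupp.single r 1)
    (psRestrict (r : ℕ) f - psRestrict ((r : ℕ) + 1) f)

theorem forall_lt_succ_iff {r : Fin n} {m : Fin n →₀ ℕ} (hm : m r = 0) :
    (∀ i : Fin n, (i : ℕ) < (r : ℕ) + 1 → m i = 0) ↔ ∀ i : Fin n, (i : ℕ) < r → m i = 0 := by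
  constructor
  · intro H i hi
    exact H i (by omega)
  · intro H i hi
    rcases Nat.lt_succ_iff_lt_or_eq.mp hi with h1 | h1
    · exact H i h1
    · rwa [Fin.ext h1]

open Classical in
theorem coeff_polyRestrict (r : ℕ) (f : MvPolynomial (Fin n) K) (m : Fin n →₀ ℕ) :
    MvPolynomial.coeff m (polyRestrict r f)
      = if ∀ i : Fin n, (i : ℕ) < r → m i = 0 then MvPolynomial.coeff m f else 0 := by
  induction f using MvPolynomial.induction_on' with
  | monomial d a =>
    rw [polyRestrict, MvPolynomial.aeval_monomial, MvPolynomial.algebraMap_eq,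
      MvPolynomial.coeff_C_mul]
    have key : (d.prod fun i k =>
        (if (i : ℕ) < r then 0 else (MvPolynomial.X i : MvPolynomial (Fin n) K)) ^ k)
        = if ∀ i : Fin n, (i : ℕ) < r → d i = 0 then MvPolynomial.monomial d 1 else 0 := by
      split_ifs with H
      · rw [MvPolynomial.monomial_eq, map_one, one_mul]
        refine Finset.prod_congr rfl fun i hi => ?_
        beta_reduce
        rw [if_neg fun h => (Finsupp.mem_support_iff.mp hi) (H i h)]
      · push Not at H
        obtain ⟨i, hi, hd⟩ := H
        refine Finset.prod_eq_zero (Finsupp.mem_support_iff.mpr hd) ?_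
        beta_reduce
        rw [if_pos hi, zero_pow hd]
    rw [key]
    by_cases hdm : d = m
    · subst hdm
      split_ifs <;> simp
    · split_ifs <;> simp [MvPolynomial.coeff_monomial, hdm]
  | add p q hp hq =>
    have : polyRestrict r (p + q) = polyRestrict r p + polyRestrict r q := map_add _ _ _
    rw [this, MvPolynomial.coeff_add, hp, hq, MvPolynomial.coeff_add]
    split_ifs <;> simp

/-- The division in the definition of `polyD` is exact. -/
theorem X_mul_polyD (r : Fin n) (f : MvPolynomial (Fin n) K) :
    MvPolynomial.X r * polyD r f = polyRestrict (r : ℕ) f - polyRestrict ((r : ℕ) + 1) f := by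
  classical
  ext m
  rw [MvPolynomial.coeff_X_mul', polyD, MvPolynomial.coeff_divMonomial]
  split_ifs with h
  · have h' : Finsupp.single r 1 ≤ m := by
      rw [Finsupp.single_le_iff]
      exact Nat.one_le_iff_ne_zero.mpr (Finsupp.mem_support_iff.mp h)
    rw [add_tsub_cancel_of_le h']
  · have hm : m r = 0 := Finsupp.notMem_support_iff.mp h
    simp only [MvPolynomial.coeff_sub, coeff_polyRestrict, forall_lt_succ_iff hm, sub_self]

open Classical in
theorem coeff_psRestrict (r : ℕ) (f : MvPowerSeries (Fin n) K) (m : Fin n →₀ ℕ) :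
    MvPowerSeries.coeff m (psRestrict r f)
      = if ∀ i : Fin n, (i : ℕ) < r → m i = 0 then MvPowerSeries.coeff m f else 0 := rfl

/-- The division in the definition of `psD` is exact. -/
theorem X_mul_psD (r : Fin n) (f : MvPowerSeries (Fin n) K) :
    MvPowerSeries.X r * psD r f = psRestrict (r : ℕ) f - psRestrict ((r : ℕ) + 1) f := by
  classical
  ext m
  change MvPowerSeries.coeff m (MvPowerSeries.monomial (Finsupp.single r 1) 1 * _) = _
  rw [MvPowerSeries.coeff_monomial_mul, one_mul]
  split_ifs with h
  · change MvPowerSeries.coeff (m - Finsupp.single r 1 + Finsupp.single r 1)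
      (psRestrict (r : ℕ) f - psRestrict ((r : ℕ) + 1) f) = _
    rw [tsub_add_cancel_of_le h]
  · have hm : m r = 0 := by
      rw [Finsupp.single_le_iff] at h
      omega
    simp only [map_sub, coeff_psRestrict, forall_lt_succ_iff hm, sub_self]

/-- `psRestrict r f` is the substitution `f(0, …, 0, x_{r+1}, …, x_n)`. -/
theorem psRestrict_eq_subst (r : ℕ) (f : MvPowerSeries (Fin n) K) :
    psRestrict r f = MvPowerSeries.subst
      (fun i : Fin n => if (i : ℕ) < r then 0 else (MvPowerSeries.X i : MvPowerSeries (Fin n) K))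
      f := by
  classical
  have ha : MvPowerSeries.HasSubst (fun i : Fin n =>
      if (i : ℕ) < r then 0 else (MvPowerSeries.X i : MvPowerSeries (Fin n) K)) := by
    refine MvPowerSeries.hasSubst_of_constantCoeff_zero fun i => ?_
    split_ifs <;> simp
  have key : ∀ d : Fin n →₀ ℕ, (d.prod fun i k =>
      (if (i : ℕ) < r then 0 else (MvPowerSeries.X i : MvPowerSeries (Fin n) K)) ^ k)
      = if ∀ i : Fin n, (i : ℕ) < r → d i = 0 then MvPowerSeries.monomial d 1 else 0 := by
    intro d
    rw [Finsupp.prod]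
    split_ifs with H
    · rw [MvPowerSeries.monomial_one_eq]
      refine Finset.prod_congr rfl fun i hi => ?_
      rw [if_neg fun h => (Finsupp.mem_support_iff.mp hi) (H i h)]
    · push Not at H
      obtain ⟨i, hi, hd⟩ := H
      refine Finset.prod_eq_zero (Finsupp.mem_support_iff.mpr hd) ?_
      rw [if_pos hi, zero_pow hd]
  ext m
  rw [MvPowerSeries.coeff_subst ha, coeff_psRestrict]
  simp_rw [key]
  rw [finsum_eq_single _ m]
  · split_ifs <;> simp
  · intro d hd
    split_ifs
    · rw [MvPowerSeries.coeff_monomial, if_neg hd.symm, smul_zero]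
    · simp

end Operators

end KoszulCycles

/-! Both `H_i(Ω ⊗ S/I)` and `F_i ⊗ K` compute `Tor_i(K, S/I)`, and they are compared through the
double complex `Ω ⊗ F`. The elements `z_{ij}` are the ends of explicit zigzags in it. Write
`z^{(m)}(α)` for the matrix of such sums of degree `m` built from a sequence of matrices `α`. Then
`∂ z^{(m+1)}(α) = α^{(1)} z^{(m)}(α')`, where `α'` drops the first matrix (`koszulD_koszulChain`),
and the zigzag stops at the identity matrix in degree 0. Since the entries of `α^{(1)}` generate
`I`, this gives cycles modulo `I`.

The identity is proved in a form that can be inducted on (`koszulD_koszulChain_aux`): only indices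
`≥ s` are allowed, and the first `s` variables are set to zero in `α^{(1)}`. Descending in `s` uses
`x_r d^r(f) = f|_r - f|_{r+1}` and the twisted Leibniz rule `d_mul`, applied to `α^{(1)} α^{(2)} =
0`.

The basis property is a diagram chase by induction on the degree, dropping one matrix at each step.
Spanning (`exists_eq_sum_koszulChain`) uses acyclicity of the Koszul complex, `exists_koszulD_eq`;
independence (`eq_zero_of_sum_koszulChain_eq`) uses exactness of `F` tensored with the free modules
`Ω_p`. In degree 0 they reduce to `S = K + 𝔫` and to `K ∩ 𝔫 = 0` together with minimality. The two
rings enter only through `VariableOps`. -/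

namespace KoszulCycles

/-! ### Contractions on the exterior algebra -/

section Contraction

variable {S : Type*} [CommRing S] {n : ℕ}

theorem linForm_apply (x a : Fin n → S) : linForm x a = ∑ r, a r * x r := by
  simp [linForm, Fintype.linearCombination_apply]

theorem linForm_single (x : Fin n → S) (r : Fin n) : linForm x (Pi.single r 1) = x r := by
  simp [linForm_apply, Pi.single_apply]

theorem linForm_single_left (r : Fin n) (a : Fin n → S) : linForm (Pi.single r 1) a = a r := by
  simp [linForm_apply, Pi.single_apply]

theorem koszulD_ι (x a : Fin n → S) :
    koszulD x (ExteriorAlgebra.ι S a) = algebraMap S _ (linForm x a) :=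
  CliffordAlgebra.contractLeft_ι (Q := (0 : QuadraticForm S (Fin n → S))) (linForm x) a

theorem koszulD_koszulD (x : Fin n → S) (w : ExteriorAlgebra S (Fin n → S)) :
    koszulD x (koszulD x w) = 0 :=
  CliffordAlgebra.contractLeft_contractLeft (Q := (0 : QuadraticForm S (Fin n → S))) (linForm x) w

theorem koszulD_comm (x y : Fin n → S) (w : ExteriorAlgebra S (Fin n → S)) :
    koszulD x (koszulD y w) = -koszulD y (koszulD x w) :=
  CliffordAlgebra.contractLeft_comm (Q := (0 : QuadraticForm S (Fin n → S))) (linForm x)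
    (linForm y) w

theorem mem_exteriorPower_zero {w : ExteriorAlgebra S (Fin n → S)} :
    w ∈ ⋀[S]^0 (Fin n → S) ↔ ∃ s, algebraMap S _ s = w := by
  change w ∈ (LinearMap.range (ExteriorAlgebra.ι S (M := Fin n → S))) ^ 0 ↔ _
  rw [pow_zero, Submodule.mem_one]

theorem mem_exteriorPower_one {w : ExteriorAlgebra S (Fin n → S)} :
    w ∈ ⋀[S]^1 (Fin n → S) ↔ ∃ a, ExteriorAlgebra.ι S a = w := by
  change w ∈ (LinearMap.range (ExteriorAlgebra.ι S (M := Fin n → S))) ^ 1 ↔ _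
  rw [pow_one, LinearMap.mem_range]

theorem ι_mul_mem {p : ℕ} (a : Fin n → S) {w : ExteriorAlgebra S (Fin n → S)}
    (hw : w ∈ ⋀[S]^p (Fin n → S)) : ExteriorAlgebra.ι S a * w ∈ ⋀[S]^(p + 1) (Fin n → S) := by
  change _ ∈ (LinearMap.range (ExteriorAlgebra.ι S (M := Fin n → S))) ^ (p + 1)
  rw [pow_succ']
  exact Submodule.mul_mem_mul ⟨a, rfl⟩ hw

theorem koszulD_eq_zero_of_mem_zero (x : Fin n → S) {w : ExteriorAlgebra S (Fin n → S)}
    (hw : w ∈ ⋀[S]^0 (Fin n → S)) : koszulD x w = 0 := by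
  obtain ⟨s, rfl⟩ := mem_exteriorPower_zero.mp hw
  exact koszulD_algebraMap x s

/-- The vector `a` with its first `s` coordinates replaced by zero. -/
def truncate (s : ℕ) (a : Fin n → S) : Fin n → S := fun r => if (r : ℕ) < s then 0 else a r

theorem truncate_succ (s : Fin n) (a : Fin n → S) :
    truncate ((s : ℕ) + 1) a = truncate s a - truncate s a s • Pi.single s 1 := by
  ext r
  rcases lt_trichotomy (r : ℕ) s with h | h | h
  · simp [truncate, h, h.trans (Nat.lt_succ_self _), Fin.ext_iff, h.ne]
  · obtain rfl := Fin.ext h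
    simp [truncate]
  · simp [truncate, Fin.ext_iff, h.ne', Nat.not_lt.mpr h.le,
      Nat.not_lt.mpr (Nat.succ_le_of_lt h)]

/-- The projection `w ↦ w - dx_s ∧ (e_s ⌟ w)`, which kills all terms divisible by `dx_s`, is
multiplicative with respect to the left multiplication by one-forms. -/
theorem ι_mul_sub_contract (s : Fin n) (v : Fin n → S) (w : ExteriorAlgebra S (Fin n → S)) :
    ExteriorAlgebra.ι S v * w - ExteriorAlgebra.ι S (Pi.single s 1) *
        koszulD (Pi.single s 1) (ExteriorAlgebra.ι S v * w)
      = ExteriorAlgebra.ι S (v - v s • Pi.single s 1) *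
        (w - ExteriorAlgebra.ι S (Pi.single s 1) * koszulD (Pi.single s 1) w) := by
  have h1 : ExteriorAlgebra.ι S (Pi.single s 1 : Fin n → S) *
      ExteriorAlgebra.ι S (Pi.single s 1) = 0 := ExteriorAlgebra.ι_sq_zero _
  have h2 : ExteriorAlgebra.ι S (Pi.single s 1 : Fin n → S) * ExteriorAlgebra.ι S v
      = -(ExteriorAlgebra.ι S v * ExteriorAlgebra.ι S (Pi.single s 1)) :=
    eq_neg_of_add_eq_zero_left (ExteriorAlgebra.ι_add_mul_swap _ _)
  rw [koszulD_ι_mul, linForm_single_left]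
  simp only [map_sub, map_smul, mul_sub, sub_mul, mul_smul_comm, smul_mul_assoc]
  simp only [← mul_assoc, h1, h2]
  simp only [zero_mul, neg_mul, smul_zero, sub_zero]
  abel

/-- The projections `u ↦ u - dx_s ∧ (e_s ⌟ u)` all fix such a `w`, but their composite over all `s`
erases every coordinate of a one-form factor, so it kills positive degree. -/
theorem eq_zero_of_contract_eq_zero {p : ℕ} {w : ExteriorAlgebra S (Fin n → S)}
    (hw : w ∈ ⋀[S]^(p + 1) (Fin n → S)) (h : ∀ r : Fin n, koszulD (Pi.single r 1) w = 0) :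
    w = 0 := by
  -- `P` is the composite of the projections for the first `s` basis forms.
  suffices H : ∀ s : ℕ, s ≤ n → ∃ P : ExteriorAlgebra S (Fin n → S) →ₗ[S]
      ExteriorAlgebra S (Fin n → S), (∀ u, (∀ r : Fin n, koszulD (Pi.single r 1) u = 0) → P u = u) ∧
      ∀ v u, P (ExteriorAlgebra.ι S v * u) = ExteriorAlgebra.ι S (truncate s v) * P u by
    obtain ⟨P, hP, hP'⟩ := H n le_rfl
    rw [← hP w h]
    change w ∈ (LinearMap.range (ExteriorAlgebra.ι S (M := Fin n → S))) ^ (p + 1) at hw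
    rw [pow_succ'] at hw
    refine Submodule.mul_induction_on hw ?_ fun u v hu hv => by rw [map_add, hu, hv, add_zero]
    rintro _ ⟨a, rfl⟩ v -
    have : truncate n a = 0 := by ext r; simp [truncate]
    rw [hP', this, map_zero, zero_mul]
  intro s
  induction s with
  | zero =>
    intro _
    exact ⟨LinearMap.id, fun _ _ => rfl, fun v u => rfl⟩
  | succ s ih =>
    intro hs
    obtain ⟨P, hP, hP'⟩ := ih (by omega)
    let e : Fin n → S := Pi.single ⟨s, hs⟩ 1
    refine ⟨(LinearMap.id - LinearMap.mulLeft S (ExteriorAlgebra.ι S e) ∘ₗ koszulD e) ∘ₗ P,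
      fun u hu => ?_, fun v u => ?_⟩
    · simp [hP u hu, e, hu]
    · simp only [LinearMap.comp_apply, LinearMap.sub_apply, LinearMap.id_apply,
        LinearMap.mulLeft_apply, hP', e]
      rw [ι_mul_sub_contract, ← truncate_succ ⟨s, hs⟩]

end Contraction

/-! ### The operators `d^r` and acyclicity of the Koszul complex on the variables -/

section Operations

/-- The structure used of a polynomial or power series ring: the substitutions setting the first
`s` variables equal to zero, and the operators `d^r` of exact division by the variable `x r`. -/
structure VariableOps (K : Type*) [Field K] {S : Type*} [CommRing S] [Algebra K S] {n : ℕ}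
    (x : Fin n → S) (d : Fin n → S → S) where
  /-- Setting the first `s` variables equal to zero. -/
  restr : ℕ → S →+* S
  /-- The constant coefficient. -/
  aug : S → K
  restr_zero : ∀ f, restr 0 f = f
  restr_last : ∀ f, restr n f = algebraMap K S (aug f)
  restr_algebraMap : ∀ k, restr n (algebraMap K S k) = algebraMap K S k
  restr_x_of_lt : ∀ (s : ℕ) (r : Fin n), (r : ℕ) < s → restr s (x r) = 0
  restr_x_self : ∀ r : Fin n, restr r (x r) = x r
  eq_zero_of_x_mul : ∀ (r : Fin n) (f : S), x r * f = 0 → f = 0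
  x_mul_d : ∀ (r : Fin n) (f : S), x r * d r f = restr r f - restr (r + 1) f

namespace VariableOps

variable {K : Type*} [Field K] {S : Type*} [CommRing S] [Algebra K S] {n : ℕ}
  {x : Fin n → S} {d : Fin n → S → S} (V : VariableOps K x d)

include V

theorem x_mul_cancel (r : Fin n) {f g : S} (h : x r * f = x r * g) : f = g :=
  sub_eq_zero.mp (V.eq_zero_of_x_mul r _ (by rw [mul_sub, h, sub_self]))

theorem d_add (r : Fin n) (f g : S) : d r (f + g) = d r f + d r g :=
  V.x_mul_cancel r (by simp only [mul_add, V.x_mul_d, map_add]; ring)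

theorem d_zero (r : Fin n) : d r 0 = 0 :=
  V.x_mul_cancel r (by simp only [V.x_mul_d, map_zero, mul_zero, sub_zero])

theorem d_sum {ι : Type*} (r : Fin n) (s : Finset ι) (f : ι → S) :
    d r (∑ i ∈ s, f i) = ∑ i ∈ s, d r (f i) :=
  map_sum (⟨⟨d r, V.d_zero r⟩, V.d_add r⟩ : S →+ S) f s

/-- Twisted Leibniz rule: write `f|_r g|_r - f|_{r+1} g|_{r+1}` as `f|_r (g|_r - g|_{r+1}) + (f|_r -
f|_{r+1}) g|_{r+1}` and cancel `x r`. -/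
theorem d_mul (r : Fin n) (f g : S) :
    d r (f * g) = V.restr r f * d r g + d r f * V.restr (r + 1) g := by
  refine V.x_mul_cancel r ?_
  have hf := V.x_mul_d r f
  have hg := V.x_mul_d r g
  rw [V.x_mul_d, map_mul, map_mul]
  linear_combination (-V.restr r f) * hg - V.restr (r + 1) g * hf

/-- An element that vanishes when the first `s` variables are set to zero is the image under the
Koszul differential of a one-form in the `dx_r` with `r < s`. -/
theorem exists_koszulD_eq_algebraMap (s : ℕ) (hs : s ≤ n) (f : S) :
    ∃ a : Fin n → S, (∀ r : Fin n, s ≤ r → a r = 0) ∧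
      linForm x a = f - V.restr s f := by
  induction s with
  | zero => exact ⟨0, by simp, by simp [V.restr_zero]⟩
  | succ s ih =>
    obtain ⟨a, ha, hf⟩ := ih (by omega)
    refine ⟨a + d ⟨s, hs⟩ f • Pi.single ⟨s, hs⟩ 1, fun r hr => ?_, ?_⟩
    · have : r ≠ ⟨s, hs⟩ := by rintro rfl; simp at hr
      simp [ha r (by omega), this]
    · have := V.x_mul_d ⟨s, hs⟩ f
      rw [map_add, map_smul, linForm_single, hf, smul_eq_mul, mul_comm, this]
      simp

/-- Acyclicity of the Koszul complex on the variables `x r` with `r < s`. -/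
theorem exists_koszulD_eq_of_contract (s : ℕ) (hs : s ≤ n) (p : ℕ)
    (w : ExteriorAlgebra S (Fin n → S)) (hw : w ∈ ⋀[S]^(p + 1) (Fin n → S))
    (hc : ∀ r : Fin n, s ≤ r → koszulD (Pi.single r 1) w = 0) (hd : koszulD x w = 0) :
    ∃ u ∈ ⋀[S]^(p + 2) (Fin n → S), (∀ r : Fin n, s ≤ r → koszulD (Pi.single r 1) u = 0) ∧
      koszulD x u = w := by
  induction s generalizing p w with
  | zero =>
    refine ⟨0, Submodule.zero_mem _, by simp, ?_⟩
    rw [map_zero, eq_zero_of_contract_eq_zero hw fun r => hc r (Nat.zero_le _)]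
  | succ s ih =>
    obtain ⟨t, rfl⟩ : ∃ t : Fin n, (t : ℕ) = s := ⟨⟨s, hs⟩, rfl⟩
    -- Split `w = a + dx_t ∧ b` with `a` and `b` free of `dx_r` for `r ≥ t`. Then `∂ w = 0` becomes
    -- `∂ b = 0` and `∂ a = -x_t b`.
    set e : Fin n → S := Pi.single t 1 with he
    set b := koszulD e w with hb
    set a := w - ExteriorAlgebra.ι S e * b with ha
    have hle : linForm e e = 1 := by rw [he, linForm_single_left, Pi.single_eq_same]
    have hler : ∀ r : Fin n, (t : ℕ) + 1 ≤ r →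
        linForm (Pi.single r 1 : Fin n → S) e = 0 := by
      intro r hr
      rw [linForm_single_left, he, Pi.single_apply, if_neg]
      rintro rfl
      omega
    have hbp : b ∈ ⋀[S]^p (Fin n → S) := koszulD_mem e p w hw
    have hap : a ∈ ⋀[S]^(p + 1) (Fin n → S) := Submodule.sub_mem _ hw (ι_mul_mem e hbp)
    have hebz : koszulD e b = 0 := koszulD_koszulD e w
    have hbr : ∀ r : Fin n, (t : ℕ) ≤ r → koszulD (Pi.single r 1) b = 0 := by
      intro r hr
      rcases hr.eq_or_lt with h | h
      · obtain rfl := Fin.ext h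
        exact hebz
      · rw [hb, koszulD_comm, hc r h, map_zero, neg_zero]
    have har : ∀ r : Fin n, (t : ℕ) ≤ r → koszulD (Pi.single r 1) a = 0 := by
      intro r hr
      rcases hr.eq_or_lt with h | h
      · obtain rfl := Fin.ext h
        rw [ha, map_sub, koszulD_ι_mul, ← he, hle, hebz, ← hb]
        simp
      · rw [ha, map_sub, koszulD_ι_mul, hler r h, hbr r hr, hc r h]
        simp
    have hdb : koszulD x b = 0 := by rw [hb, koszulD_comm, hd, map_zero, neg_zero]
    have hda : koszulD x a = -(x t • b) := by
      rw [ha, map_sub, hd, koszulD_ι_mul, hdb, he, linForm_single]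
      simp
    obtain ⟨b', hb'p, hb'r, hb'⟩ : ∃ u ∈ ⋀[S]^(p + 1) (Fin n → S),
        (∀ r : Fin n, (t : ℕ) ≤ r → koszulD (Pi.single r 1) u = 0) ∧ koszulD x u = b := by
      cases p with
      | succ p => exact ih (by omega) p b hbp hbr hdb
      -- In degree 0 acyclicity fails, so being a cycle is not enough for `b = β`. But `x_t β = -∂
      -- a` lies in the ideal of the earlier variables; setting these to zero and cancelling `x_t`
      -- shows that `β` vanishes there too.
      | zero =>
        obtain ⟨β, hβ⟩ := mem_exteriorPower_zero.mp hbp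
        obtain ⟨v, hv⟩ := mem_exteriorPower_one.mp hap
        have hvr : ∀ r : Fin n, (t : ℕ) ≤ r → v r = 0 := by
          intro r hr
          have := har r hr
          rwa [← hv, koszulD_ι, linForm_single_left, ExteriorAlgebra.algebraMap_eq_zero_iff] at this
        have hβ0 : V.restr t β = 0 := by
          refine V.eq_zero_of_x_mul t _ ?_
          rw [← hv, koszulD_ι, ← hβ, Algebra.smul_def, ← map_mul, ← map_neg,
            ExteriorAlgebra.algebraMap_inj] at hda
          have h1 := congrArg (V.restr t) hda
          rw [map_neg, map_mul, V.restr_x_self, linForm_apply, map_sum,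
            Finset.sum_eq_zero fun r _ => ?_] at h1
          · exact neg_eq_zero.mp h1.symm
          · rcases lt_or_ge (r : ℕ) t with h | h
            · rw [map_mul, V.restr_x_of_lt _ _ h, mul_zero]
            · rw [hvr r h, zero_mul, map_zero]
        obtain ⟨c, hc, hcβ⟩ := V.exists_koszulD_eq_algebraMap t (by omega) β
        refine ⟨ExteriorAlgebra.ι S c, mem_exteriorPower_one.mpr ⟨c, rfl⟩, fun r hr => ?_, ?_⟩
        · rw [koszulD_ι, linForm_single_left, hc r hr, map_zero]
        · rw [koszulD_ι, hcβ, hβ0, sub_zero, hβ]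
    -- With `∂ b' = b`, the element `a + x_t b'` is a cycle in the earlier variables. If `∂ a'`
    -- equals it, then `∂ (a' - dx_t ∧ b') = a + dx_t ∧ b = w`.
    obtain ⟨a', ha'p, ha'r, ha'⟩ := ih (by omega) p (a + x t • b')
      (Submodule.add_mem _ hap (Submodule.smul_mem _ _ hb'p))
      (fun r hr => by rw [map_add, map_smul, har r hr, hb'r r hr, smul_zero, add_zero])
      (by rw [map_add, map_smul, hda, hb', neg_add_cancel])
    refine ⟨a' - ExteriorAlgebra.ι S e * b', Submodule.sub_mem _ ha'p (ι_mul_mem e hb'p),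
      fun r hr => ?_, ?_⟩
    · rw [map_sub, koszulD_ι_mul, hler r hr, hb'r r (by omega), ha'r r (by omega)]
      simp
    · rw [map_sub, koszulD_ι_mul, ha', hb', he, linForm_single, ← he, ha]
      abel

/-- The Koszul complex on the variables is acyclic in positive degrees. -/
theorem exists_koszulD_eq {p : ℕ} {w : ExteriorAlgebra S (Fin n → S)}
    (hw : w ∈ ⋀[S]^(p + 1) (Fin n → S)) (hd : koszulD x w = 0) :
    ∃ u ∈ ⋀[S]^(p + 2) (Fin n → S), koszulD x u = w := by
  obtain ⟨u, hu, -, h⟩ := V.exists_koszulD_eq_of_contract n le_rfl p w hw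
    (fun r hr => absurd r.2 (by omega)) hd
  exact ⟨u, hu, h⟩

theorem restr_eq_zero_of_mem {f : S} (hf : f ∈ Ideal.span (Set.range x)) :
    V.restr n f = 0 := by
  have : Ideal.span (Set.range x) ≤ RingHom.ker (V.restr n) := by
    rw [Ideal.span_le]
    rintro _ ⟨r, rfl⟩
    exact V.restr_x_of_lt n r r.2
  exact this hf

theorem span_ne_top [Nontrivial S] : Ideal.span (Set.range x) ≠ ⊤ := by
  intro h
  have h1 : V.restr n 1 = 0 := V.restr_eq_zero_of_mem (h ▸ Submodule.mem_top)
  rw [map_one] at h1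
  exact one_ne_zero h1

end VariableOps

end Operations

/-! ### The chains behind `z_{ij}` and their recursion -/

section Chains

variable {S : Type*} [CommRing S] {n : ℕ}

/-- The definition peels off the last factor; the inductions drop the first matrix of the
resolution, so the first factor has to be split off instead. -/
theorem prodMatrix_succ (d : Fin n → S → S) (m : ℕ) {b : ℕ → ℕ}
    (α : ∀ i, Matrix (Fin (b i)) (Fin (b (i + 1))) S) (r : Fin (m + 1) → Fin n) :
    prodMatrix d α (m + 1) r = (α 0).map (d (r 0)) *
      prodMatrix (b := fun i => b (i + 1)) d (fun i => α (i + 1)) m (Fin.tail r) := by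
  induction m with
  | zero =>
    simp only [prodMatrix, Nat.reduceAdd]
    rw [Matrix.one_mul]
    exact (Matrix.mul_one _).symm
  | succ m ih =>
    rw [prodMatrix, ih, Matrix.mul_assoc]
    rfl

open Classical in
/-- The sum of the `d^{r_1}(α^{(1)}) ⋯ d^{r_m}(α^{(m)}) dx_{r_1} ∧ ⋯ ∧ dx_{r_m}` with
`s ≤ r_1 < ⋯ < r_m`, as a matrix with entries in the exterior algebra. -/
noncomputable def koszulChain (d : Fin n → S → S) (s m : ℕ) {b : ℕ → ℕ}
    (α : ∀ i, Matrix (Fin (b i)) (Fin (b (i + 1))) S) (a : Fin (b 0)) (j : Fin (b m)) :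
    ExteriorAlgebra S (Fin n → S) :=
  ∑ r : Fin m → Fin n, if StrictMono r ∧ ∀ l, s ≤ r l then
    prodMatrix d α m r a j • ExteriorAlgebra.ιMulti S m fun l => (Pi.single (r l) 1 : Fin n → S)
  else 0

theorem koszulChain_mem (d : Fin n → S → S) (s m : ℕ) {b : ℕ → ℕ}
    (α : ∀ i, Matrix (Fin (b i)) (Fin (b (i + 1))) S) (a : Fin (b 0)) (j : Fin (b m)) :
    koszulChain d s m α a j ∈ ⋀[S]^m (Fin n → S) := by
  refine Submodule.sum_mem _ fun r _ => ?_
  split_ifs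
  · exact Submodule.smul_mem _ _ (ExteriorAlgebra.ιMulti_range S m ⟨_, rfl⟩)
  · exact Submodule.zero_mem _

theorem koszulChain_zero (d : Fin n → S → S) (s : ℕ) {b : ℕ → ℕ}
    (α : ∀ i, Matrix (Fin (b i)) (Fin (b (i + 1))) S) (a j : Fin (b 0)) :
    koszulChain d s 0 α a j = algebraMap S _ ((1 : Matrix (Fin (b 0)) (Fin (b 0)) S) a j) := by
  rw [koszulChain, Fintype.sum_unique, if_pos ⟨fun l => l.elim0, fun l => l.elim0⟩,
    ExteriorAlgebra.ιMulti_zero_apply, Algebra.algebraMap_eq_smul_one]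
  rfl

theorem sum_smul_koszulChain_zero (d : Fin n → S → S) {b : ℕ → ℕ}
    (α : ∀ i, Matrix (Fin (b i)) (Fin (b (i + 1))) S) (κ : Fin (b 0) → S) (a : Fin (b 0)) :
    ∑ j, κ j • koszulChain d 0 0 α a j = algebraMap S _ (κ a) := by
  simp only [koszulChain_zero, Algebra.smul_def, ← map_mul, Matrix.one_apply]
  rw [← map_sum]
  simp

theorem strictMono_cons_iff {m : ℕ} (s : ℕ) (t : Fin n) (r : Fin m → Fin n) :
    (StrictMono (Fin.cons t r : Fin (m + 1) → Fin n) ∧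
      ∀ l, s ≤ ((Fin.cons t r : Fin (m + 1) → Fin n) l : ℕ)) ↔
    s ≤ t ∧ StrictMono r ∧ ∀ l, (t : ℕ) + 1 ≤ r l := by
  constructor
  · rintro ⟨h, hs⟩
    refine ⟨by simpa using hs 0, fun i j hij => ?_, fun l => ?_⟩
    · simpa using h (Fin.succ_lt_succ_iff.mpr hij)
    · simpa using h (Fin.succ_pos l)
  · rintro ⟨hs, h, ht⟩
    constructor
    · intro i j hij
      induction j using Fin.cases with
      | zero => simp at hij
      | succ j =>
        induction i using Fin.cases with
        | zero => simpa using ht j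
        | succ i => simpa using h (Fin.succ_lt_succ_iff.mp hij)
    · intro l
      induction l using Fin.cases with
      | zero => simpa using hs
      | succ l => simpa using hs.trans ((Nat.le_succ _).trans (ht l))

/-- Sort the terms by their smallest index `t = r_1`; the remaining indices are then `≥ t + 1`. -/
theorem koszulChain_succ (d : Fin n → S → S) (s m : ℕ) {b : ℕ → ℕ}
    (α : ∀ i, Matrix (Fin (b i)) (Fin (b (i + 1))) S) (a : Fin (b 0)) (j : Fin (b (m + 1))) :
    koszulChain d s (m + 1) α a j = ∑ t : Fin n, if s ≤ (t : ℕ) then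
      ∑ c, d t (α 0 a c) • (ExteriorAlgebra.ι S (Pi.single t 1) *
        koszulChain (b := fun i => b (i + 1)) d (t + 1) m (fun i => α (i + 1)) c j) else 0 := by
  rw [koszulChain, ← (Fin.consEquiv fun _ => Fin n).sum_comp, Fintype.sum_prod_type]
  refine Finset.sum_congr rfl fun t _ => ?_
  refine (Finset.sum_congr rfl fun r _ =>
    if_congr (strictMono_cons_iff s t r) rfl rfl).trans ?_
  split_ifs with hs
  · simp only [hs, true_and, koszulChain, Finset.mul_sum, Finset.smul_sum]
    rw [Finset.sum_comm]
    refine Finset.sum_congr rfl fun r _ => ?_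
    split_ifs with hr
    · rw [prodMatrix_succ, Matrix.mul_apply, Finset.sum_smul]
      refine Finset.sum_congr rfl fun c _ => ?_
      rw [ExteriorAlgebra.ιMulti_succ_apply, mul_smul_comm, smul_smul]
      rfl
    · simp only [mul_zero, smul_zero, Finset.sum_const_zero]
  · simp only [hs, false_and, if_false, Finset.sum_const_zero]

theorem koszulChain_of_le (d : Fin n → S → S) {s : ℕ} (hs : n ≤ s) (m : ℕ) {b : ℕ → ℕ}
    (α : ∀ i, Matrix (Fin (b i)) (Fin (b (i + 1))) S) (a : Fin (b 0)) (j : Fin (b (m + 1))) :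
    koszulChain d s (m + 1) α a j = 0 := by
  rw [koszulChain_succ]
  exact Finset.sum_eq_zero fun t _ => if_neg (by omega)

/-- Isolates the terms with `r_1 = s`, which is the step of the descending induction on `s`. -/
theorem koszulChain_succ_eq_add (d : Fin n → S → S) (s : Fin n) (m : ℕ) {b : ℕ → ℕ}
    (α : ∀ i, Matrix (Fin (b i)) (Fin (b (i + 1))) S) (a : Fin (b 0)) (j : Fin (b (m + 1))) :
    koszulChain d s (m + 1) α a j = koszulChain d (s + 1) (m + 1) α a j +
      ∑ c, d s (α 0 a c) • (ExteriorAlgebra.ι S (Pi.single s 1) *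
        koszulChain (b := fun i => b (i + 1)) d (s + 1) m (fun i => α (i + 1)) c j) := by
  have key : ∀ f : Fin n → ExteriorAlgebra S (Fin n → S), (∑ t : Fin n, if (s : ℕ) ≤ t then f t else 0)
      = (∑ t : Fin n, if (s : ℕ) + 1 ≤ t then f t else 0) + f s := by
    intro f
    rw [← Finset.sum_ite_eq' Finset.univ s f |>.trans (if_pos (Finset.mem_univ s)),
      ← Finset.sum_add_distrib]
    refine Finset.sum_congr rfl fun t _ => ?_
    simp only [Fin.ext_iff]
    split_ifs <;> first | omega | simp
  rw [koszulChain_succ, koszulChain_succ]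
  exact key _

/-- The inclusion of `Ω_i` into the exterior algebra. -/
def omegaVal (S : Type*) [CommRing S] (n i : ℕ) :
    Omega S n i →ₗ[S] ExteriorAlgebra S (Fin n → S) :=
  (⋀[S]^i (Fin n → S)).subtype

theorem omegaVal_injective (i : ℕ) : Function.Injective (omegaVal S n i) :=
  Subtype.val_injective

theorem omegaVal_mem {i : ℕ} (w : Omega S n i) : omegaVal S n i w ∈ ⋀[S]^i (Fin n → S) :=
  Subtype.prop w

theorem exists_omegaVal_eq {i : ℕ} {w : ExteriorAlgebra S (Fin n → S)}
    (hw : w ∈ ⋀[S]^i (Fin n → S)) : ∃ v, omegaVal S n i v = w :=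
  ⟨⟨w, hw⟩, rfl⟩

theorem omegaVal_koszulDiff (x : Fin n → S) (i : ℕ) (w : Omega S n (i + 1)) :
    omegaVal S n i (koszulDiff x i w) = koszulD x (omegaVal S n (i + 1) w) := rfl

theorem omegaVal_zElem (d : Fin n → S → S) {b : ℕ → ℕ}
    (α : ∀ i, Matrix (Fin (b i)) (Fin (b (i + 1))) S) (a : Fin (b 0)) (i : ℕ) (j : Fin (b i)) :
    omegaVal S n i (zElem d α a i j) = koszulChain d 0 i α a j := by
  classical
  have h1 : omegaVal S n i (zElem d α a i j) = ∑ r : Fin i ↪o Fin n,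
      prodMatrix d α i r a j •
        ExteriorAlgebra.ιMulti S i fun l => (Pi.single (r l) 1 : Fin n → S) := by
    refine (map_sum (omegaVal S n i) _ _).trans ?_
    rfl
  rw [h1, koszulChain, ← Finset.sum_filter]
  refine Finset.sum_bij (fun r _ => r) (fun r _ => ?_) (fun r _ r' _ h => ?_) (fun r hr => ?_)
    fun r _ => rfl
  · simpa using r.strictMono
  · exact DFunLike.coe_injective h
  · exact ⟨OrderEmbedding.ofStrictMono r (Finset.mem_filter.mp hr).2.1, Finset.mem_univ _, rfl⟩

end Chains

/-! ### Exact sequences of matrices and the differential of the chains -/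

section Chase

variable {S : Type*} [CommRing S] {n : ℕ}

/-- A sequence of matrices describing an exact complex of finite free modules which is minimal
with respect to the ideal `𝔫`. -/
structure IsMinimalExact (𝔫 : Ideal S) {b : ℕ → ℕ}
    (α : ∀ i, Matrix (Fin (b i)) (Fin (b (i + 1))) S) : Prop where
  mul_eq_zero : ∀ k, α k * α (k + 1) = 0
  exact : ∀ k v, (α k).mulVec v = 0 → ∃ w, (α (k + 1)).mulVec w = v
  mem : ∀ k a c, α k a c ∈ 𝔫

namespace IsMinimalExact

variable {𝔫 : Ideal S} {b : ℕ → ℕ} {α : ∀ i, Matrix (Fin (b i)) (Fin (b (i + 1))) S}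

/-- Nothing is required of the cokernel of `α 0`, so the conditions survive dropping the first
matrix. This is what lets the chases induct over syzygies. -/
theorem shift (h : IsMinimalExact 𝔫 α) :
    IsMinimalExact (b := fun i => b (i + 1)) 𝔫 fun i => α (i + 1) :=
  ⟨fun _ => h.mul_eq_zero _, fun _ => h.exact _, fun _ => h.mem _⟩

theorem sum_smul_sum_smul (h : IsMinimalExact 𝔫 α) {M : Type*} [AddCommGroup M] [Module S M]
    (w : Fin (b 2) → M) (a : Fin (b 0)) :
    ∑ c, α 0 a c • ∑ e, α 1 c e • w e = 0 := by
  simp only [Finset.smul_sum, smul_smul]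
  rw [Finset.sum_comm]
  refine Finset.sum_eq_zero fun e _ => ?_
  rw [← Finset.sum_smul]
  have := congrFun (congrFun (h.mul_eq_zero 0) a) e
  rw [Matrix.mul_apply] at this
  rw [this, Matrix.zero_apply, zero_smul]

/-- Exactness is preserved by the tensor product with an exterior power of a free module. -/
theorem exists_eq_sum_smul (h : IsMinimalExact 𝔫 α) {p : ℕ}
    (v : Fin (b 1) → ExteriorAlgebra S (Fin n → S)) (hv : ∀ c, v c ∈ ⋀[S]^p (Fin n → S))
    (hα : ∀ a, ∑ c, α 0 a c • v c = 0) :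
    ∃ w : Fin (b 2) → ExteriorAlgebra S (Fin n → S), (∀ e, w e ∈ ⋀[S]^p (Fin n → S)) ∧
      ∀ c, v c = ∑ e, α 1 c e • w e := by
  let B := Module.Free.chooseBasis S (⋀[S]^p (Fin n → S))
  let v' : Fin (b 1) → ⋀[S]^p (Fin n → S) := fun c => ⟨v c, hv c⟩
  have hv' : ∀ a, ∑ c, α 0 a c • v' c = 0 := fun a => by
    apply Subtype.ext
    simpa [v'] using hα a
  -- Exactness is applied to each coordinate with respect to a basis of the exterior power.
  have hex : ∀ i, ∃ w, (α 1).mulVec w = fun c => B.repr (v' c) i := by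
    intro i
    refine h.exact 0 _ (funext fun a => ?_)
    have := congrArg (fun y => B.repr y i) (hv' a)
    simpa [Matrix.mulVec, dotProduct] using this
  choose w hw using hex
  refine ⟨fun e => (∑ i, w i e • B i : ⋀[S]^p (Fin n → S)), fun e => Subtype.prop _, fun c => ?_⟩
  have key : v' c = ∑ e, α 1 c e • ∑ i, w i e • B i := by
    conv_lhs => rw [← B.sum_repr (v' c)]
    simp only [Finset.smul_sum, smul_smul]
    rw [Finset.sum_comm]
    refine Finset.sum_congr rfl fun i _ => ?_
    rw [← Finset.sum_smul, ← congrFun (hw i) c]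
    rfl
  simpa [v'] using congrArg Subtype.val key

variable {K : Type*} [Field K] [Algebra K S] {x : Fin n → S} {d : Fin n → S → S}
  (V : VariableOps K x d)

include V

/-- The Koszul differential of `koszulChain`. -/
theorem koszulD_koszulChain_aux {b : ℕ → ℕ} {α : ∀ i, Matrix (Fin (b i)) (Fin (b (i + 1))) S}
    (h : IsMinimalExact (Ideal.span (Set.range x)) α) (s : ℕ) (hs : s ≤ n) (m : ℕ)
    (a : Fin (b 0)) (j : Fin (b (m + 1))) :
    koszulD x (koszulChain d s (m + 1) α a j) =
      ∑ c, V.restr s (α 0 a c) •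
        koszulChain (b := fun i => b (i + 1)) d s m (fun i => α (i + 1)) c j := by
  induction hs using Nat.decreasingInduction generalizing m b with
  | self =>
    -- At `s = n` no index is left, and on the right all entries lie in `𝔫` by minimality, hence
    -- vanish when every variable is set to zero.
    rw [koszulChain_of_le d le_rfl, map_zero]
    exact (Finset.sum_eq_zero fun c _ => by
      rw [V.restr_eq_zero_of_mem (h.mem _ _ _), zero_smul]).symm
  | of_succ s hs ih =>
    obtain ⟨t, rfl⟩ : ∃ t : Fin n, (t : ℕ) = s := ⟨⟨s, hs⟩, rfl⟩
    rw [koszulChain_succ_eq_add, map_add, ih h, map_sum]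
    simp only [map_smul, koszulD_ι_mul, linForm_single, smul_sub]
    rw [Finset.sum_sub_distrib, ← add_sub_assoc, ← Finset.sum_add_distrib]
    -- The part `x_t w` of `∂ (dx_t ∧ w) = x_t w - dx_t ∧ ∂ w` turns the restriction at `t + 1` into
    -- the one at `t`.
    have h1 : ∀ c, V.restr (t + 1) (α 0 a c) • koszulChain (b := fun i => b (i + 1)) d (t + 1) m
          (fun i => α (i + 1)) c j + d t (α 0 a c) • x t • koszulChain (b := fun i => b (i + 1))
          d (t + 1) m (fun i => α (i + 1)) c j
        = V.restr t (α 0 a c) • koszulChain (b := fun i => b (i + 1)) d (t + 1) m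
          (fun i => α (i + 1)) c j := by
      intro c
      rw [smul_smul, ← add_smul, mul_comm, V.x_mul_d, add_sub_cancel]
    simp only [h1]
    cases m with
    | zero =>
      simp only [koszulChain_zero, koszulD_algebraMap, mul_zero, smul_zero, Finset.sum_const_zero,
        sub_zero]
    | succ m =>
      simp only [ih h.shift, koszulChain_succ_eq_add (b := fun i => b (i + 1)) d t m, smul_add,
        Finset.sum_add_distrib]
      rw [sub_eq_add_neg, add_right_inj, neg_eq_iff_add_eq_zero]
      simp only [Finset.mul_sum, Finset.smul_sum, mul_smul_comm, smul_smul]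
      rw [Finset.sum_comm, Finset.sum_comm (s := Finset.univ (α := Fin (b 1)))]
      rw [← Finset.sum_add_distrib]
      refine Finset.sum_eq_zero fun e _ => ?_
      rw [← Finset.sum_smul, ← Finset.sum_smul, ← add_smul]
      -- The remaining terms are multiples of `dx_t ∧ z`; their coefficients add up to the Leibniz
      -- expansion of `d^t` of an entry of `α 0 * α 1 = 0`.
      have := congrArg (d t) (congrFun (congrFun (h.mul_eq_zero 0) a) e)
      rw [Matrix.mul_apply, V.d_sum, Matrix.zero_apply, V.d_zero] at this
      simp only [V.d_mul, Finset.sum_add_distrib] at this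
      rw [add_comm, this, zero_smul]

theorem koszulD_koszulChain (h : IsMinimalExact (Ideal.span (Set.range x)) α) (m : ℕ)
    (a : Fin (b 0)) (j : Fin (b (m + 1))) :
    koszulD x (koszulChain d 0 (m + 1) α a j) =
      ∑ c, α 0 a c • koszulChain (b := fun i => b (i + 1)) d 0 m (fun i => α (i + 1)) c j := by
  rw [koszulD_koszulChain_aux V h 0 (Nat.zero_le _)]
  simp only [V.restr_zero]

end IsMinimalExact

end Chase

/-! ### The double complex chase: spanning and independence -/

section ChaseResults

namespace IsMinimalExact

variable {S : Type*} [CommRing S] {n : ℕ} {K : Type*} [Field K] [Algebra K S]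
  {x : Fin n → S} {d : Fin n → S → S} (V : VariableOps K x d)

include V

theorem koszulD_sum_smul_koszulChain {b : ℕ → ℕ}
    {α : ∀ i, Matrix (Fin (b i)) (Fin (b (i + 1))) S}
    (h : IsMinimalExact (Ideal.span (Set.range x)) α) (m : ℕ) (κ : Fin (b (m + 1)) → S)
    (a : Fin (b 0)) :
    koszulD x (∑ j, κ j • koszulChain d 0 (m + 1) α a j) = ∑ c, α 0 a c •
      ∑ j, κ j • koszulChain (b := fun i => b (i + 1)) d 0 m (fun i => α (i + 1)) c j := by
  simp only [map_sum, map_smul, koszulD_koszulChain V h, Finset.smul_sum]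
  rw [Finset.sum_comm]
  simp only [smul_smul, mul_comm]

/-- Relative cycles are, up to relative boundaries, combinations of the chains `koszulChain`
with constant coefficients. -/
theorem exists_eq_sum_koszulChain {b : ℕ → ℕ} {α : ∀ i, Matrix (Fin (b i)) (Fin (b (i + 1))) S}
    (h : IsMinimalExact (Ideal.span (Set.range x)) α) (m : ℕ)
    (v : Fin (b 0) → ExteriorAlgebra S (Fin n → S)) (hv : ∀ a, v a ∈ ⋀[S]^m (Fin n → S))
    (v' : Fin (b 1) → ExteriorAlgebra S (Fin n → S)) (hv' : ∀ c, v' c ∈ ⋀[S]^(m - 1) (Fin n → S))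
    (hd : ∀ a, koszulD x (v a) = ∑ c, α 0 a c • v' c) :
    ∃ (κ : Fin (b m) → K) (u : Fin (b 0) → ExteriorAlgebra S (Fin n → S))
      (w : Fin (b 1) → ExteriorAlgebra S (Fin n → S)),
      (∀ a, u a ∈ ⋀[S]^(m + 1) (Fin n → S)) ∧ (∀ c, w c ∈ ⋀[S]^m (Fin n → S)) ∧
      ∀ a, v a = ∑ j, algebraMap K S (κ j) • koszulChain d 0 m α a j + koszulD x (u a) +
        ∑ c, α 0 a c • w c := by
  induction m generalizing b with
  | zero =>
    choose f hf using fun a => mem_exteriorPower_zero.mp (hv a)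
    choose g hg hfg using fun a => V.exists_koszulD_eq_algebraMap n le_rfl (f a)
    -- The coefficients are the constant terms; `f a` minus its constant term is the Koszul boundary
    -- of `g a`.
    refine ⟨fun a => V.aug (f a), fun a => ExteriorAlgebra.ι S (g a), 0,
      fun a => mem_exteriorPower_one.mpr ⟨_, rfl⟩, fun c => Submodule.zero_mem _, fun a => ?_⟩
    rw [sum_smul_koszulChain_zero d α (fun a => algebraMap K S (V.aug (f a))), ← V.restr_last,
      koszulD_ι, hfg, ← map_add, add_sub_cancel, hf]
    simp
  | succ m ih =>
    obtain ⟨v'', hv'', hdv''⟩ : ∃ v'' : Fin (b 2) → ExteriorAlgebra S (Fin n → S),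
        (∀ e, v'' e ∈ ⋀[S]^(m - 1) (Fin n → S)) ∧
        ∀ c, koszulD x (v' c) = ∑ e, α 1 c e • v'' e := by
      cases m with
      | zero =>
        -- Here `v'` has degree 0, so its differential vanishes; the degree `0 - 1` asked of `v''`
        -- is 0 by truncated subtraction, and `v'' = 0` is in it.
        refine ⟨0, fun e => Submodule.zero_mem _, fun c => ?_⟩
        rw [koszulD_eq_zero_of_mem_zero x (hv' c)]
        simp
      | succ m =>
        refine h.exists_eq_sum_smul _ (fun c => koszulD_mem x m _ (hv' c)) fun a => ?_
        simp only [← map_smul]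
        rw [← map_sum, ← hd, koszulD_koszulD]
    obtain ⟨κ, u, w, hu, hw, huw⟩ := ih h.shift v' hv' v'' hv'' hdv''
    -- Write `v' = κ z' + ∂ u + α^{(2)} w`, with `z'` the chains of the shifted sequence. The
    -- differential of `v - κ z - α^{(1)} u` is then `α^{(1)} α^{(2)} w = 0`, and acyclicity makes
    -- this element a boundary.
    have hcyc : ∀ a, koszulD x (v a - ∑ j, algebraMap K S (κ j) • koszulChain d 0 (m + 1) α a j -
        ∑ c, α 0 a c • u c) = 0 := by
      intro a
      rw [map_sub, map_sub, koszulD_sum_smul_koszulChain V h m (fun j => algebraMap K S (κ j)),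
        hd]
      simp only [huw, smul_add, Finset.sum_add_distrib, map_sum, map_smul]
      rw [h.sum_smul_sum_smul w a]
      abel
    choose y hy hdy using fun a => V.exists_koszulD_eq (Submodule.sub_mem _ (Submodule.sub_mem _
      (hv a) (Submodule.sum_mem _ fun j _ => Submodule.smul_mem _ (algebraMap K S (κ j))
        (koszulChain_mem d 0 (m + 1) α a j))) (Submodule.sum_mem _ fun c _ =>
          Submodule.smul_mem _ (α 0 a c) (hu c))) (hcyc a)
    exact ⟨κ, y, u, hy, hu, fun a => by rw [hdy]; abel⟩

/-- A combination of the chains `koszulChain` with constant coefficients that is a relative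
boundary has zero coefficients. -/
theorem eq_zero_of_sum_koszulChain_eq {b : ℕ → ℕ}
    {α : ∀ i, Matrix (Fin (b i)) (Fin (b (i + 1))) S}
    (h : IsMinimalExact (Ideal.span (Set.range x)) α) [Nontrivial S] (m : ℕ)
    (κ : Fin (b m) → K)
    (u : Fin (b 0) → ExteriorAlgebra S (Fin n → S)) (hu : ∀ a, u a ∈ ⋀[S]^(m + 1) (Fin n → S))
    (w : Fin (b 1) → ExteriorAlgebra S (Fin n → S)) (hw : ∀ c, w c ∈ ⋀[S]^m (Fin n → S))
    (huw : ∀ a, ∑ j, algebraMap K S (κ j) • koszulChain d 0 m α a j =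
      koszulD x (u a) + ∑ c, α 0 a c • w c) (j : Fin (b m)) : κ j = 0 := by
  induction m generalizing b with
  | zero =>
    obtain ⟨g, hg⟩ := mem_exteriorPower_one.mp (hu j)
    choose f hf using fun c => mem_exteriorPower_zero.mp (hw c)
    have h1 := huw j
    rw [sum_smul_koszulChain_zero d α (fun a => algebraMap K S (κ a)), ← hg, koszulD_ι] at h1
    simp only [← hf, Algebra.smul_def (A := ExteriorAlgebra S (Fin n → S)), ← map_mul] at h1
    rw [← map_sum, ← map_add, ExteriorAlgebra.algebraMap_inj] at h1
    -- The boundary term is a combination of variables, and the other term lies in `𝔫` by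
    -- minimality; a constant in `𝔫` is zero.
    have h2 : algebraMap K S (κ j) ∈ Ideal.span (Set.range x) := by
      rw [h1, linForm_apply]
      exact add_mem (sum_mem fun r _ => Ideal.mul_mem_left _ _ (Ideal.subset_span ⟨r, rfl⟩))
        (sum_mem fun c _ => Ideal.mul_mem_right _ _ (h.mem _ _ _))
    have h3 := V.restr_eq_zero_of_mem h2
    rwa [V.restr_algebraMap, map_eq_zero] at h3
  | succ m ih =>
    let y : Fin (b 1) → ExteriorAlgebra S (Fin n → S) := fun c => ∑ j, algebraMap K S (κ j) •
      koszulChain (b := fun i => b (i + 1)) d 0 m (fun i => α (i + 1)) c j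
    have hy : ∀ c, y c ∈ ⋀[S]^m (Fin n → S) := fun c =>
      Submodule.sum_mem _ fun j _ => Submodule.smul_mem _ _
        (koszulChain_mem (b := fun i => b (i + 1)) d 0 m (fun i => α (i + 1)) c j)
    -- Applying `∂` to the relation gives `α^{(1)} (y - ∂ w) = 0`; exactness turns this into the
    -- same kind of relation for the shifted sequence.
    obtain ⟨w', hw', hdw'⟩ := h.exists_eq_sum_smul (fun c => y c - koszulD x (w c))
      (fun c => Submodule.sub_mem _ (hy c) (koszulD_mem x m _ (hw c))) (fun a => by
        have := congrArg (koszulD x) (huw a)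
        rw [koszulD_sum_smul_koszulChain V h m (fun j => algebraMap K S (κ j)), map_add,
          koszulD_koszulD] at this
        simp only [zero_add, map_sum, map_smul] at this
        simp only [smul_sub, Finset.sum_sub_distrib]
        exact sub_eq_zero.mpr this)
    exact ih h.shift κ w hw w' hw' (fun c => by rw [← hdw' c, add_sub_cancel]) j

end IsMinimalExact

end ChaseResults

/-! ### Lifting cycles and boundaries modulo `I` to the exterior algebra -/

section Homology

variable {S : Type*} [CommRing S] {n : ℕ}

theorem toKoszulMod_eq_zero_iff (I : Ideal S) (i : ℕ) (w : Omega S n i) :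
    toKoszulMod n I i w = 0 ↔ w ∈ I • (⊤ : Submodule S (Omega S n i)) := by
  rw [← Submodule.Quotient.mk_eq_zero,
    ← TensorProduct.quotTensorEquivQuotSMul_mk_one_tmul, LinearEquiv.map_eq_zero_iff]
  rfl

theorem toKoszulMod_surjective (I : Ideal S) (i : ℕ) :
    Function.Surjective (toKoszulMod n I i) :=
  TensorProduct.mk_surjective S (Omega S n i) (S ⧸ I) Ideal.Quotient.mk_surjective

theorem koszulDiffMod_toKoszulMod (x : Fin n → S) (I : Ideal S) (i : ℕ) (w : Omega S n (i + 1)) :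
    koszulDiffMod x I i (toKoszulMod n I (i + 1) w) = toKoszulMod n I i (koszulDiff x i w) :=
  LinearMap.lTensor_tmul _ _ _ _

variable {ι : Type*} [Fintype ι] {g : ι → S} {I : Ideal S}

theorem toKoszulMod_eq_zero_iff_exists (hI : I = Ideal.span (Set.range g)) {i : ℕ}
    (w : Omega S n i) : toKoszulMod n I i w = 0 ↔
      ∃ v : ι → ExteriorAlgebra S (Fin n → S), (∀ c, v c ∈ ⋀[S]^i (Fin n → S)) ∧
        omegaVal S n i w = ∑ c, g c • v c := by
  rw [toKoszulMod_eq_zero_iff]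
  constructor
  · intro hw
    refine Submodule.smul_induction_on hw (fun r hr y _ => ?_) ?_
    · rw [hI, Ideal.mem_span_range_iff_exists_fun] at hr
      obtain ⟨c, rfl⟩ := hr
      refine ⟨fun j => c j • omegaVal S n i y,
        fun j => Submodule.smul_mem _ _ (omegaVal_mem y), ?_⟩
      simp only [map_smul, map_sum, Finset.sum_smul, smul_smul, mul_comm]
    · rintro y y' ⟨v, hv, hy⟩ ⟨v', hv', hy'⟩
      refine ⟨v + v', fun c => Submodule.add_mem _ (hv c) (hv' c), ?_⟩
      simp only [map_add, hy, hy', Pi.add_apply, smul_add, Finset.sum_add_distrib]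
  · rintro ⟨v, hv, h⟩
    choose y hy using fun c => exists_omegaVal_eq (hv c)
    have : w = ∑ c, g c • y c := omegaVal_injective i (by simp only [h, map_sum, map_smul, hy])
    rw [this]
    exact Submodule.sum_mem _ fun c _ =>
      Submodule.smul_mem_smul (hI ▸ Ideal.subset_span ⟨c, rfl⟩) trivial

/-- Lifts a boundary modulo `I` to `Ω`, where the error in `I Ω_i` is spelled out on the generators
`g`. With `g` the row of `α^{(1)}`, this is the shape of relation used in the chase. -/
theorem toKoszulMod_mem_boundaries_iff (x : Fin n → S) (hI : I = Ideal.span (Set.range g)) {i : ℕ}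
    (w : Omega S n i) : toKoszulMod n I i w ∈ boundaries x I i ↔
      ∃ u ∈ ⋀[S]^(i + 1) (Fin n → S), ∃ v : ι → ExteriorAlgebra S (Fin n → S),
        (∀ c, v c ∈ ⋀[S]^i (Fin n → S)) ∧
        omegaVal S n i w = koszulD x u + ∑ c, g c • v c := by
  have key : ∀ u : Omega S n (i + 1), koszulDiffMod x I i (toKoszulMod n I (i + 1) u) =
      toKoszulMod n I i w ↔ ∃ v : ι → ExteriorAlgebra S (Fin n → S),
        (∀ c, v c ∈ ⋀[S]^i (Fin n → S)) ∧
        omegaVal S n i w = koszulD x (omegaVal S n (i + 1) u) + ∑ c, g c • v c := by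
    intro u
    rw [koszulDiffMod_toKoszulMod, eq_comm, ← sub_eq_zero, ← map_sub,
      toKoszulMod_eq_zero_iff_exists hI]
    simp only [map_sub, omegaVal_koszulDiff, sub_eq_iff_eq_add']
  constructor
  · rintro ⟨u', hu'⟩
    obtain ⟨u, rfl⟩ := toKoszulMod_surjective I (i + 1) u'
    exact ⟨_, omegaVal_mem u, (key u).mp hu'⟩
  · rintro ⟨u', hu', h⟩
    obtain ⟨u, rfl⟩ := exists_omegaVal_eq hu'
    exact ⟨_, (key u).mpr h⟩

theorem toKoszulMod_mem_cycles_iff (x : Fin n → S) (hI : I = Ideal.span (Set.range g)) {i : ℕ}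
    (w : Omega S n (i + 1)) : toKoszulMod n I (i + 1) w ∈ cycles x I (i + 1) ↔
      ∃ v : ι → ExteriorAlgebra S (Fin n → S), (∀ c, v c ∈ ⋀[S]^i (Fin n → S)) ∧
        koszulD x (omegaVal S n (i + 1) w) = ∑ c, g c • v c := by
  rw [← omegaVal_koszulDiff, ← toKoszulMod_eq_zero_iff_exists hI, ← koszulDiffMod_toKoszulMod]
  exact LinearMap.mem_ker

theorem homologyClass_eq_iff (x : Fin n → S) (I : Ideal S) (i : ℕ) {c c' : KoszulMod n I i}
    (hc : c ∈ cycles x I i) (hc' : c' ∈ cycles x I i) :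
    homologyClass x I i c hc = homologyClass x I i c' hc' ↔ c - c' ∈ boundaries x I i :=
  Submodule.Quotient.eq _

theorem exists_homologyClass_eq (x : Fin n → S) (I : Ideal S) (i : ℕ)
    (y : KoszulHomology x I i) : ∃ c hc, homologyClass x I i c hc = y := by
  obtain ⟨⟨c, hc⟩, h⟩ := Submodule.mkQ_surjective _ y
  exact ⟨c, hc, h⟩

theorem sum_smul_homologyClass {K : Type*} [Field K] [Algebra K S] (x : Fin n → S) (I : Ideal S)
    (i : ℕ) {ι : Type*} [Fintype ι] (κ : ι → K) (c : ι → KoszulMod n I i)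
    (hc : ∀ j, c j ∈ cycles x I i) :
    ∑ j, κ j • homologyClass x I i (c j) (hc j) =
      homologyClass x I i (∑ j, algebraMap K S (κ j) • c j)
        (Submodule.sum_mem _ fun j _ => Submodule.smul_mem _ _ (hc j)) := by
  have h : (⟨∑ j, algebraMap K S (κ j) • c j,
      Submodule.sum_mem _ fun j _ => Submodule.smul_mem _ _ (hc j)⟩ : cycles x I i) =
      ∑ j, algebraMap K S (κ j) • (⟨c j, hc j⟩ : cycles x I i) :=
    Subtype.ext (by simp)
  refine Eq.trans ?_ (congrArg ((boundaries x I i).submoduleOf (cycles x I i)).mkQ h).symm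
  exact (map_sum ((boundaries x I i).submoduleOf (cycles x I i)).mkQ _ _).symm

theorem homologyClass_eq_zero_iff (x : Fin n → S) (I : Ideal S) (i : ℕ) {c : KoszulMod n I i}
    (hc : c ∈ cycles x I i) : homologyClass x I i c hc = 0 ↔ c ∈ boundaries x I i :=
  Submodule.Quotient.mk_eq_zero _

end Homology

/-! ### From the resolution to matrices, and the basis of the homology -/

section Main

variable {S : Type*} [CommRing S] {n : ℕ} {F : ℕ → Type*}
  [∀ i, AddCommGroup (F i)] [∀ i, Module S (F i)]

theorem repr_mem_of_mem_smul_top {ι M : Type*} [AddCommGroup M] [Module S M]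
    (B : Module.Basis ι S M) {J : Ideal S} {y : M} (hy : y ∈ J • (⊤ : Submodule S M)) (k : ι) :
    B.repr y k ∈ J := by
  refine Submodule.smul_induction_on hy (fun r hr z _ => ?_) fun z z' hz hz' => ?_
  · simpa using J.mul_mem_right _ hr
  · simpa using J.add_mem hz hz'

theorem diffMatrix_eq_toMatrix (δ : ∀ i, F (i + 1) →ₗ[S] F i) {b : ℕ → ℕ}
    (e : ∀ i, Module.Basis (Fin (b i)) S (F i)) (i : ℕ) :
    diffMatrix δ e i = LinearMap.toMatrix (e (i + 1)) (e i) (δ i) := by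
  ext a c
  rw [LinearMap.toMatrix_apply]
  rfl

theorem diffMatrix_mulVec_repr (δ : ∀ i, F (i + 1) →ₗ[S] F i) {b : ℕ → ℕ}
    (e : ∀ i, Module.Basis (Fin (b i)) S (F i)) (i : ℕ) (y : F (i + 1)) :
    (diffMatrix δ e i).mulVec ((e (i + 1)).repr y) = (e i).repr (δ i y) := by
  rw [diffMatrix_eq_toMatrix]
  exact LinearMap.toMatrix_mulVec_repr (e (i + 1)) (e i) (δ i) y

namespace IsMinimalFreeResolution

variable {𝔫 I : Ideal S} {ε : F 0 →ₗ[S] S ⧸ I} {δ : ∀ i, F (i + 1) →ₗ[S] F i} {b : ℕ → ℕ}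

theorem isMinimalExact (h : IsMinimalFreeResolution 𝔫 I ε δ)
    (e : ∀ i, Module.Basis (Fin (b i)) S (F i)) : IsMinimalExact 𝔫 (diffMatrix δ e) where
  mul_eq_zero k := by
    rw [diffMatrix_eq_toMatrix, diffMatrix_eq_toMatrix, ← LinearMap.toMatrix_comp,
      (h.exact_succ k).linearMap_comp_eq_zero, map_zero]
  exact k v hv := by
    obtain ⟨y, hy⟩ : ∃ y : F (k + 1), ⇑((e (k + 1)).repr y) = v :=
      ⟨(e (k + 1)).equivFun.symm v, (e (k + 1)).equivFun.apply_symm_apply v⟩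
    rw [← hy, diffMatrix_mulVec_repr] at hv
    have h0 : δ k y = 0 := by
      apply (e k).repr.injective
      rw [map_zero]
      exact DFunLike.coe_injective hv
    obtain ⟨z, rfl⟩ := (h.exact_succ k y).mp h0
    exact ⟨(e (k + 1 + 1)).repr z, by rw [diffMatrix_mulVec_repr, hy]⟩
  mem k a c := repr_mem_of_mem_smul_top (e k) (h.minimal k ⟨_, rfl⟩) a

/-- For a lift `t` of `1`, every element of `F 0` is a multiple of `t` modulo `ker ε ⊆ 𝔫 F 0`. Two
basis vectors would both be multiples of `t` modulo `𝔫`, which forces `1 ∈ 𝔫`; no basis vector at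
all would give `I = ⊤`. -/
theorem rank_zero_eq_one (h : IsMinimalFreeResolution 𝔫 I ε δ) (hI : I ≠ ⊤) (h𝔫 : 𝔫 ≠ ⊤)
    (e : ∀ i, Module.Basis (Fin (b i)) S (F i)) : b 0 = 1 := by
  obtain ⟨t, ht⟩ := h.surjective 1
  have hker : ∀ (c : S) (y : F 0), ε y = Ideal.Quotient.mk I c → ∀ a,
      (e 0).repr y a - c * (e 0).repr t a ∈ 𝔫 := by
    intro c y hy a
    have h0 : ε (y - c • t) = 0 := by
      rw [map_sub, map_smul, ht, hy, sub_eq_zero, Algebra.smul_def, mul_one]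
      rfl
    have h1 : y - c • t ∈ 𝔫 • (⊤ : Submodule S (F 0)) := by
      obtain ⟨z, hz⟩ := (h.exact_zero _).mp h0
      exact h.minimal 0 ⟨z, hz⟩
    simpa using repr_mem_of_mem_smul_top (e 0) h1 a
  have hb : 0 < b 0 := by
    by_contra hb
    have : IsEmpty (Fin (b 0)) := by
      rw [Nat.eq_zero_of_not_pos hb]
      infer_instance
    have ht0 : t = 0 := (e 0).ext_elem fun a => isEmptyElim a
    rw [ht0, map_zero] at ht
    refine hI ((Ideal.eq_top_iff_one I).mpr ?_)
    rw [← Ideal.Quotient.eq_zero_iff_mem, map_one, ht]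
  have hb' : b 0 < 2 := by
    by_contra hb'
    let a : Fin (b 0) := ⟨0, by omega⟩
    let a' : Fin (b 0) := ⟨1, by omega⟩
    have haa : a' ≠ a := by simp [a, a', Fin.ext_iff]
    obtain ⟨c, hc⟩ := Ideal.Quotient.mk_surjective (ε (e 0 a))
    obtain ⟨c', hc'⟩ := Ideal.Quotient.mk_surjective (ε (e 0 a'))
    have h1 := hker c _ hc.symm a
    have h2 := hker c _ hc.symm a'
    have h3 := hker c' _ hc'.symm a'
    simp only [Module.Basis.repr_self, Finsupp.single_eq_same,
      Finsupp.single_eq_of_ne haa] at h1 h2 h3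
    refine h𝔫 ((Ideal.eq_top_iff_one _).mpr ?_)
    -- With `t_a` the coordinates of `t`: `(1 - c t_a) + c t_a (1 - c' t_{a'}) - c' t_a (0 - c
    -- t_{a'}) = 1`.
    have h4 := 𝔫.add_mem (𝔫.add_mem h1 (𝔫.mul_mem_left (c * (e 0).repr t a) h3))
      (𝔫.mul_mem_left (-(c' * (e 0).repr t a)) h2)
    convert h4 using 1
    ring
  omega

/-- `ε (e 0 j₀)` generates `S/I`, so its annihilator is `I`; by exactness that annihilator is the
ideal of coordinates of the image of `δ 0`. -/
theorem eq_span_row (h : IsMinimalFreeResolution 𝔫 I ε δ)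
    (e : ∀ i, Module.Basis (Fin (b i)) S (F i)) (hb : b 0 = 1) (j₀ : Fin (b 0)) :
    I = Ideal.span (Set.range (diffMatrix δ e 0 j₀)) := by
  have hsub : Subsingleton (Fin (b 0)) := by
    rw [hb]
    infer_instance
  have hy : ∀ y : F 0, y = (e 0).repr y j₀ • e 0 j₀ := fun y => by
    refine (e 0).ext_elem fun a => ?_
    rw [Subsingleton.elim a j₀]
    simp
  apply le_antisymm
  · intro s hs
    have h0 : ε (s • e 0 j₀) = 0 := by
      obtain ⟨q, hq⟩ := Ideal.Quotient.mk_surjective (ε (e 0 j₀))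
      rw [map_smul, ← hq]
      exact Ideal.Quotient.eq_zero_iff_mem.mpr (I.mul_mem_right q hs)
    obtain ⟨y, hy'⟩ := (h.exact_zero _).mp h0
    have h1 := congrFun (diffMatrix_mulVec_repr δ e 0 y) j₀
    rw [hy'] at h1
    rw [Ideal.mem_span_range_iff_exists_fun]
    refine ⟨(e (0 + 1)).repr y, ?_⟩
    simpa [Matrix.mulVec, dotProduct, mul_comm] using h1
  · rw [Ideal.span_le]
    rintro _ ⟨c, rfl⟩
    obtain ⟨t, ht⟩ := h.surjective 1
    have h0 : ε (δ 0 (e (0 + 1) c)) = 0 := (h.exact_zero _).mpr ⟨_, rfl⟩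
    have h1 : diffMatrix δ e 0 j₀ c • ε (e 0 j₀) = 0 := by
      rw [← map_smul, ← h0]
      exact congrArg ε (hy (δ 0 (e (0 + 1) c))).symm
    have h2 : diffMatrix δ e 0 j₀ c • (1 : S ⧸ I) = 0 := by
      rw [← ht, hy t, map_smul, smul_comm, h1, smul_zero]
    rw [Algebra.smul_def, mul_one] at h2
    exact Ideal.Quotient.eq_zero_iff_mem.mp h2

variable {K : Type*} [Field K] [Algebra K S] [Nontrivial S] {x : Fin n → S} {d : Fin n → S → S}

/-- The classes of the cycles `z̄_{ij}` form a basis of the Koszul homology. -/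
theorem exists_basis_koszulHomology (V : VariableOps K x d) (hI : I ≠ ⊤)
    (h : IsMinimalFreeResolution (Ideal.span (Set.range x)) I ε δ)
    (e : ∀ i, Module.Basis (Fin (b i)) S (F i)) :
    b 0 = 1 ∧ ∀ (j₀ : Fin (b 0)) (i : ℕ), 1 ≤ i → i ≤ n →
      ∃ hz : ∀ j : Fin (b i), zBar I d (diffMatrix δ e) j₀ i j ∈ cycles x I i,
        ∃ B : Module.Basis (Fin (b i)) K (KoszulHomology x I i),
          ∀ j, B j = homologyClass x I i _ (hz j) := by
  have hb := h.rank_zero_eq_one hI V.span_ne_top e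
  refine ⟨hb, fun j₀ i hi _ => ?_⟩
  have hsub : Subsingleton (Fin (b 0)) := by
    rw [hb]
    infer_instance
  have hspan := h.eq_span_row e hb j₀
  have hα := h.isMinimalExact e
  set α := diffMatrix δ e
  obtain ⟨m, rfl⟩ : ∃ m, i = m + 1 := ⟨i - 1, by omega⟩
  have hz : ∀ j : Fin (b (m + 1)), zBar I d α j₀ (m + 1) j ∈ cycles x I (m + 1) := fun j => by
    refine (toKoszulMod_mem_cycles_iff x hspan _).mpr ⟨_, fun c =>
      koszulChain_mem (b := fun i => b (i + 1)) d 0 m (fun i => α (i + 1)) c j, ?_⟩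
    rw [omegaVal_zElem, IsMinimalExact.koszulD_koszulChain V hα]
  have hsum : ∀ κ : Fin (b (m + 1)) → K,
      ∑ j, algebraMap K S (κ j) • zBar I d α j₀ (m + 1) j =
        toKoszulMod n I (m + 1) (∑ j, algebraMap K S (κ j) • zElem d α j₀ (m + 1) j) := by
    intro κ
    rw [map_sum]
    simp only [map_smul]
    rfl
  have hval : ∀ κ : Fin (b (m + 1)) → K,
      omegaVal S n (m + 1) (∑ j, algebraMap K S (κ j) • zElem d α j₀ (m + 1) j) =
        ∑ j, algebraMap K S (κ j) • koszulChain d 0 (m + 1) α j₀ j := by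
    intro κ
    simp only [map_sum, map_smul, omegaVal_zElem]
  have hli : LinearIndependent K fun j => homologyClass x I (m + 1) _ (hz j) := by
    rw [Fintype.linearIndependent_iff]
    intro κ hκ j
    rw [sum_smul_homologyClass, homologyClass_eq_zero_iff, hsum,
      toKoszulMod_mem_boundaries_iff x hspan] at hκ
    obtain ⟨u, hu, v, hv, huv⟩ := hκ
    rw [hval] at huv
    -- As `b 0 = 1`, a family indexed by `Fin (b 0)` is a single element, so constant families
    -- suffice.
    refine IsMinimalExact.eq_zero_of_sum_koszulChain_eq V hα (m + 1) κ (fun _ => u)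
      (fun _ => hu) v hv (fun a => ?_) j
    rw [Subsingleton.elim a j₀, huv]
  have hsp : ⊤ ≤ Submodule.span K
      (Set.range fun j => homologyClass x I (m + 1) _ (hz j)) := by
    rintro y -
    obtain ⟨c, hc, rfl⟩ := exists_homologyClass_eq x I (m + 1) y
    obtain ⟨w, rfl⟩ := toKoszulMod_surjective I (m + 1) c
    obtain ⟨v', hv', hdv⟩ := (toKoszulMod_mem_cycles_iff x hspan w).mp hc
    obtain ⟨κ, u, w', hu, hw', huw⟩ := IsMinimalExact.exists_eq_sum_koszulChain V hα (m + 1)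
      (fun _ => omegaVal S n (m + 1) w) (fun _ => omegaVal_mem w) v' hv'
      (fun a => by rw [Subsingleton.elim a j₀, hdv])
    rw [Submodule.mem_span_range_iff_exists_fun]
    refine ⟨κ, ?_⟩
    rw [sum_smul_homologyClass, eq_comm, homologyClass_eq_iff, hsum, ← map_sub,
      toKoszulMod_mem_boundaries_iff x hspan]
    refine ⟨u j₀, hu j₀, w', hw', ?_⟩
    rw [map_sub, hval, huw j₀]
    abel
  exact ⟨hz, Module.Basis.mk hli hsp, fun j => Module.Basis.mk_apply hli hsp j⟩

end IsMinimalFreeResolution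

end Main

/-! ### The polynomial ring and the power series ring -/

section Instances

variable (K : Type*) [Field K] (n : ℕ)

/-- The operations on the polynomial ring. -/
noncomputable def polyOps :
    VariableOps K (MvPolynomial.X : Fin n → MvPolynomial (Fin n) K) polyD where
  restr s := (MvPolynomial.aeval fun i : Fin n =>
    if (i : ℕ) < s then 0 else (MvPolynomial.X i : MvPolynomial (Fin n) K)).toRingHom
  aug f := MvPolynomial.constantCoeff f
  restr_zero f := by simp
  restr_last f := by
    classical
    ext m
    refine (coeff_polyRestrict n f m).trans ?_
    have : (∀ i : Fin n, (i : ℕ) < n → m i = 0) ↔ 0 = m := by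
      simp [Finsupp.ext_iff, eq_comm]
    rw [MvPolynomial.algebraMap_eq, MvPolynomial.coeff_C]
    simp only [this]
    split_ifs with h
    · subst h
      rfl
    · rfl
  restr_algebraMap k := by simp
  restr_x_of_lt s r h := by simp [h]
  restr_x_self r := by simp
  eq_zero_of_x_mul r f h := (mul_eq_zero.mp h).resolve_left (MvPolynomial.X_ne_zero r)
  x_mul_d r f := X_mul_polyD r f

theorem hasSubst_restrict (s : ℕ) : MvPowerSeries.HasSubst (fun i : Fin n =>
    if (i : ℕ) < s then 0 else (MvPowerSeries.X i : MvPowerSeries (Fin n) K)) := by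
  refine MvPowerSeries.hasSubst_of_constantCoeff_zero fun i => ?_
  split_ifs <;> simp

theorem substAlgHom_eq_psRestrict (s : ℕ) (f : MvPowerSeries (Fin n) K) :
    MvPowerSeries.substAlgHom (hasSubst_restrict K n s) f = psRestrict s f := by
  rw [MvPowerSeries.substAlgHom_apply, psRestrict_eq_subst]

/-- The operations on the power series ring. -/
noncomputable def psOps :
    VariableOps K (MvPowerSeries.X : Fin n → MvPowerSeries (Fin n) K) psD where
  restr s := (MvPowerSeries.substAlgHom (R := K) (hasSubst_restrict K n s)).toRingHom
  aug f := MvPowerSeries.constantCoeff f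
  restr_zero f := by
    refine (substAlgHom_eq_psRestrict K n 0 f).trans ?_
    ext m
    rw [coeff_psRestrict, if_pos (by simp)]
  restr_last f := by
    classical
    refine (substAlgHom_eq_psRestrict K n n f).trans ?_
    ext m
    rw [coeff_psRestrict, MvPowerSeries.algebraMap_apply, MvPowerSeries.coeff_C]
    have : (∀ i : Fin n, (i : ℕ) < n → m i = 0) ↔ m = 0 := by
      simp [Finsupp.ext_iff]
    simp only [this]
    split_ifs with h
    · subst h
      simp
    · rfl
  restr_algebraMap k := AlgHom.commutes (MvPowerSeries.substAlgHom (hasSubst_restrict K n n)) k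
  restr_x_of_lt s r h := by
    refine (MvPowerSeries.substAlgHom_X (hasSubst_restrict K n s) r).trans ?_
    exact if_pos h
  restr_x_self r := by
    refine (MvPowerSeries.substAlgHom_X (hasSubst_restrict K n r) r).trans ?_
    exact if_neg (lt_irrefl _)
  eq_zero_of_x_mul r f h := by
    refine (mul_eq_zero.mp h).resolve_left fun h0 => ?_
    simpa using congrArg (MvPowerSeries.coeff (Finsupp.single r 1)) h0
  x_mul_d r f := by
    refine (X_mul_psD r f).trans ?_
    rw [← substAlgHom_eq_psRestrict, ← substAlgHom_eq_psRestrict]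
    rfl

end Instances

end KoszulCycles

theorem theorem1p3 {K : Type*} [Field K] (n : ℕ) :
    -- the polynomial ring and a proper graded ideal
    (∀ (I : Ideal (MvPolynomial (Fin n) K)), I ≠ ⊤ →
      I.IsHomogeneous (MvPolynomial.homogeneousSubmodule (Fin n) K) →
      ∀ (F : ℕ → Type*) [∀ i, AddCommGroup (F i)] [∀ i, Module (MvPolynomial (Fin n) K) (F i)]
        (ε : F 0 →ₗ[MvPolynomial (Fin n) K] MvPolynomial (Fin n) K ⧸ I)
        (δ : ∀ i, F (i + 1) →ₗ[MvPolynomial (Fin n) K] F i),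
      KoszulCycles.IsMinimalFreeResolution
        (Ideal.span (Set.range (MvPolynomial.X : Fin n → MvPolynomial (Fin n) K))) I ε δ →
      ∀ (b : ℕ → ℕ) (e : ∀ i, Module.Basis (Fin (b i)) (MvPolynomial (Fin n) K) (F i)),
      b 0 = 1 ∧ ∀ (j₀ : Fin (b 0)) (i : ℕ), 1 ≤ i → i ≤ n →
        ∃ hz : ∀ j : Fin (b i),
            KoszulCycles.zBar I KoszulCycles.polyD (KoszulCycles.diffMatrix δ e) j₀ i j ∈
              KoszulCycles.cycles MvPolynomial.X I i,
          ∃ B : Module.Basis (Fin (b i)) K (KoszulCycles.KoszulHomology MvPolynomial.X I i),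
            ∀ j, B j = KoszulCycles.homologyClass MvPolynomial.X I i _ (hz j)) ∧
    -- the power series ring and a proper ideal
    (∀ (I : Ideal (MvPowerSeries (Fin n) K)), I ≠ ⊤ →
      ∀ (F : ℕ → Type*) [∀ i, AddCommGroup (F i)] [∀ i, Module (MvPowerSeries (Fin n) K) (F i)]
        (ε : F 0 →ₗ[MvPowerSeries (Fin n) K] MvPowerSeries (Fin n) K ⧸ I)
        (δ : ∀ i, F (i + 1) →ₗ[MvPowerSeries (Fin n) K] F i),
      KoszulCycles.IsMinimalFreeResolution
        (Ideal.span (Set.range (MvPowerSeries.X : Fin n → MvPowerSeries (Fin n) K))) I ε δ →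
      ∀ (b : ℕ → ℕ) (e : ∀ i, Module.Basis (Fin (b i)) (MvPowerSeries (Fin n) K) (F i)),
      b 0 = 1 ∧ ∀ (j₀ : Fin (b 0)) (i : ℕ), 1 ≤ i → i ≤ n →
        ∃ hz : ∀ j : Fin (b i),
            KoszulCycles.zBar I KoszulCycles.psD (KoszulCycles.diffMatrix δ e) j₀ i j ∈
              KoszulCycles.cycles MvPowerSeries.X I i,
          ∃ B : Module.Basis (Fin (b i)) K (KoszulCycles.KoszulHomology MvPowerSeries.X I i),
            ∀ j, B j = KoszulCycles.homologyClass MvPowerSeries.X I i _ (hz j)) := by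
  constructor
  · intro I hI _ F _ _ ε δ h b e
    exact h.exists_basis_koszulHomology (KoszulCycles.polyOps K n) hI e
  · intro I hI F _ _ ε δ h b e
    exact h.exists_basis_koszulHomology (KoszulCycles.psOps K n) hI e
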